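/- Let $\gamma>1$ and $0<r_0<r_1$. Consider radially symmetric steady flows of a polytropic gas, i.e. functions $\rho>0$ (density), $U_1,U_2$ (radial and angular velocity) and $A>0$ of the radius $r$, with pressure $p=A\rho^\gamma$, sound speed $c=\sqrt{\gamma p/\rho}$, Bernoulli function $B=\frac12(U_1^2+U_2^2)+\frac{\gamma p}{(\gamma-1)\rho}$ and $|\mathbf M|^2=(U_1^2+U_2^2)/c^2$; the flow is called supersonic, sonic or subsonic where $|\mathbf M|^2>1$, $=1$, $<1$. They satisfy the radial Euler system $$(\rho U_1)'+\tfrac1r\rho U_1=0,\quad U_1U_1'+\tfrac1\rho p'-\tfrac{U_2^2}{r}=0,\quad U_1U_2'+\tfrac{U_1U_2}{r}=0,\quad U_1A'=0 .\qquad (E)$$ Incoming data $\rho(r_0)=\rho_0>0$, $U_1(r_0)=U_{10}$, $U_2(r_0)=U_{20}$, $A(r_0)=A_0>0$ are given which are supersonic in the radial direction, $U_{10}>\sqrt{\gamma A_0\rho_0^{\gamma-1}}$, and have $U_{20}\ne0$. For a number $p_{ex}$, a *shock solution* with exit pressure $p_{ex}$ consists of a radius $r_b\in(r_0,r_1)$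 and two solutions $(\rho^\pm,U_1^\pm,U_2^\pm,A^\pm)$ of (E), "$-$" on $(r_0,r_b)$ and "$+$" on $(r_b,r_1)$, each $C^1$ inside and continuous up to the boundary circles, such that the "$-$" flow takes the given data at $r_0$, $p^+(r_1)=p_{ex}$, and at $r_b$ the quantities $\rho U_1$, $\rho U_1^2+p$, $\rho U_1U_2$ and $B$ have no jump while $p^+(r_b)>p^-(r_b)$. Put $\kappa_1=r_0\rho_0U_{10}$, $\kappa_2=r_0U_{20}$, $B_0=\frac12(U_{10}^2+U_{20}^2)+\frac{\gamma A_0}{\gamma-1}\rho_0^{\gamma-1}$, $r_*=\sqrt{\frac{\gamma\kappa_2^2}{(\gamma-1)B_0}}$, $$\rho^\sharp=\frac{\gamma(\gamma+1)p_{ex}}{2(\gamma-1)B_0},\qquad f_2(\rho)=\frac{\gamma p_{ex}}{\gamma-1}\rho-\Big(B_0-\frac{\kappa_2^2}{2r_1^2}\Big)\rho^2+\frac{\kappa_1^2}{2r_1^2},$$ $$f_1(r)=\Big(1-\frac{(U_2^-)^2}{\frac{2(\gamma-1)}{\gamma+1}B_0-\frac{\gamma-1}{\gamma+1}(U_2^-)^2}\Big)\frac{(U_1^-)^2}{(c^-)^2},$$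 where $f_1$ is computed along the smooth solution of (E) with $U_1^->c^-$ that has the given data at $r_0$, continued outwards and inwards from $r_0$ as far as it exists. There is exactly one radius $r'_*>r_*$ with $f_1(r'_*)=1$. **Theorem.** There are constants $p_1<p_0$ such that for every $p_{ex}\in(p_1,p_0)$ there is exactly one shock solution with exit pressure $p_{ex}$. It is $C^\infty$ up to the boundary on both sides of the shock, $U_1^->c^-$ on $(r_0,r_b)$, and $U_1^+<c^+$ on $(r_b,r_1)$. Moreover: (A) $r_b$ is a strictly decreasing function of $p_{ex}\in(p_1,p_0)$, with $r_b\to r_1$ as $p_{ex}\to p_1$ and $r_b\to r_0$ as $p_{ex}\to p_0$. (B) Always $|\mathbf M^-(r_b)|^2>1$, and the flow behind the shock is as follows. 1. Let $r_1\le r'_*$ and $p_{ex}\in(p_1,p_0)$. Then $|\mathbf M^+(r_b)|^2>1$ (supersonic-supersonic shock), and (1.1) if $f_2(\rho^\sharp)>0$, the flow is supersonic on $[r_b,r_1]$; (1.2) if $f_2(\rho^\sharp)<0$, there is $r_c\in(r_b,r_1)$ such that the flow is supersonic on $[r_b,r_c)$, sonic at $r_c$ and subsonic on $(r_c,r_1]$;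 (1.3) if $f_2(\rho^\sharp)=0$, the flow is supersonic on $[r_b,r_1)$ and sonic at $r_1$. 2. Let $r_0<r'_*<r_1$. Then there is $p'_*\in(p_1,p_0)$ such that (2.1)-(2.3) for $p_{ex}\in(p'_*,p_0)$ the conclusions of 1, with (1.1)-(1.3), hold; (2.4) for $p_{ex}\in(p_1,p'_*)$ the flow is subsonic on $[r_b,r_1]$ (supersonic-subsonic shock); (2.5) for $p_{ex}=p'_*$ the flow is sonic at $r_b$ and subsonic on $(r_b,r_1]$ (supersonic-sonic shock). 3. Let $r_0\ge r'_*$ and $p_{ex}\in(p_1,p_0)$. Then the shock is supersonic-subsonic and the flow is uniformly subsonic on $[r_b,r_1]$: $\sup_{[r_b,r_1]}|\mathbf M^+|^2<1$. -/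

import Mathlib

open Set Filter Topology
open scoped ContDiff

noncomputable section

/-- A radially symmetric flow of a polytropic gas: density `ρ`, radial velocity `U₁`, angular
velocity `U₂`, and the entropy function `A` (so that `p = A ρ ^ γ`), as functions of the radius. -/
structure RadialFlow where
  ρ : ℝ → ℝ
  U₁ : ℝ → ℝ
  U₂ : ℝ → ℝ
  A : ℝ → ℝ

namespace RadialFlow

/-- Pressure `p = A ρ ^ γ`. -/
def pressure (w : RadialFlow) (γ r : ℝ) : ℝ := w.A r * w.ρ r ^ γ

/-- Sound speed `c = √(γ p / ρ)`. -/
def soundSpeed (w : RadialFlow) (γ r : ℝ) : ℝ := Real.sqrt (γ * w.pressure γ r / w.ρ r)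

/-- Bernoulli function `B = |U|² / 2 + γ p / ((γ - 1) ρ)`. -/
def bernoulli (w : RadialFlow) (γ r : ℝ) : ℝ :=
  (w.U₁ r ^ 2 + w.U₂ r ^ 2) / 2 + γ * w.pressure γ r / ((γ - 1) * w.ρ r)

/-- Squared total Mach number `|M|² = (U₁² + U₂²) / c²`. -/
def machSq (w : RadialFlow) (γ r : ℝ) : ℝ :=
  (w.U₁ r ^ 2 + w.U₂ r ^ 2) / w.soundSpeed γ r ^ 2

/-- All the unknowns are smooth on the set `s`. -/
def SmoothOn (w : RadialFlow) (s : Set ℝ) : Prop :=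
  ContDiffOn ℝ ∞ w.ρ s ∧ ContDiffOn ℝ ∞ w.U₁ s ∧ ContDiffOn ℝ ∞ w.U₂ s ∧ ContDiffOn ℝ ∞ w.A s

/-- Two flows coincide on the set `s`. -/
def AgreeOn (w v : RadialFlow) (s : Set ℝ) : Prop :=
  EqOn w.ρ v.ρ s ∧ EqOn w.U₁ v.U₁ s ∧ EqOn w.U₂ v.U₂ s ∧ EqOn w.A v.A s

/-- `w` is a classical solution of the radially symmetric steady Euler system for `a < r < b`:
it is `C¹` in the open annulus and continuous up to the boundary circles (so that boundary values
and traces are meaningful), with positive density and positive `A`. -/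
structure IsEulerOn (w : RadialFlow) (γ a b : ℝ) : Prop where
  cont_ρ : ContinuousOn w.ρ (Icc a b)
  cont_U₁ : ContinuousOn w.U₁ (Icc a b)
  cont_U₂ : ContinuousOn w.U₂ (Icc a b)
  cont_A : ContinuousOn w.A (Icc a b)
  diff_ρ : ContDiffOn ℝ 1 w.ρ (Ioo a b)
  diff_U₁ : ContDiffOn ℝ 1 w.U₁ (Ioo a b)
  diff_U₂ : ContDiffOn ℝ 1 w.U₂ (Ioo a b)
  diff_A : ContDiffOn ℝ 1 w.A (Ioo a b)
  ρ_pos : ∀ r ∈ Icc a b, 0 < w.ρ r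
  A_pos : ∀ r ∈ Icc a b, 0 < w.A r
  mass : ∀ r ∈ Ioo a b, deriv (fun s => w.ρ s * w.U₁ s) r + 1 / r * (w.ρ r * w.U₁ r) = 0
  radial_momentum : ∀ r ∈ Ioo a b,
    w.U₁ r * deriv w.U₁ r + 1 / w.ρ r * deriv (w.pressure γ) r - w.U₂ r ^ 2 / r = 0
  angular_momentum : ∀ r ∈ Ioo a b, w.U₁ r * deriv w.U₂ r + w.U₁ r * w.U₂ r / r = 0
  entropy : ∀ r ∈ Ioo a b, w.U₁ r * deriv w.A r = 0

end RadialFlow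

/-- State of the incoming flow prescribed on the entrance circle `r = r₀`. -/
structure Inlet where
  r₀ : ℝ
  ρ₀ : ℝ
  U₁₀ : ℝ
  U₂₀ : ℝ
  A₀ : ℝ

namespace Inlet

/-- `κ₁ = r₀ ρ₀ U₁₀`. -/
def κ₁ (d : Inlet) : ℝ := d.r₀ * d.ρ₀ * d.U₁₀

/-- `κ₂ = r₀ U₂₀`. -/
def κ₂ (d : Inlet) : ℝ := d.r₀ * d.U₂₀

/-- Bernoulli constant of the incoming flow. -/
def B₀ (d : Inlet) (γ : ℝ) : ℝ :=
  (d.U₁₀ ^ 2 + d.U₂₀ ^ 2) / 2 + d.A₀ * γ / (γ - 1) * d.ρ₀ ^ (γ - 1)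

/-- Admissible data: positive density and entropy function, the flow enters supersonically in the
radial direction, `U₁₀ > c(r₀) > 0`, and with nonzero angular velocity. -/
structure Admissible (d : Inlet) (γ : ℝ) : Prop where
  r₀_pos : 0 < d.r₀
  ρ₀_pos : 0 < d.ρ₀
  A₀_pos : 0 < d.A₀
  supersonic : Real.sqrt (γ * d.A₀ * d.ρ₀ ^ (γ - 1)) < d.U₁₀
  angular : d.U₂₀ ≠ 0

/-- The flow `w` takes the prescribed values on the entrance circle. -/
def Matches (d : Inlet) (w : RadialFlow) : Prop :=
  w.ρ d.r₀ = d.ρ₀ ∧ w.U₁ d.r₀ = d.U₁₀ ∧ w.U₂ d.r₀ = d.U₂₀ ∧ w.A d.r₀ = d.A₀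

/-- The function `f₁` computed along a flow `w` (the smooth flow generated by the data). -/
def f₁ (d : Inlet) (γ : ℝ) (w : RadialFlow) (r : ℝ) : ℝ :=
  (1 - w.U₂ r ^ 2 /
      (2 * (γ - 1) / (γ + 1) * d.B₀ γ - (γ - 1) / (γ + 1) * w.U₂ r ^ 2)) *
    (w.U₁ r ^ 2 / w.soundSpeed γ r ^ 2)

/-- `r_* = √(γ κ₂² / ((γ - 1) B₀))`. -/
def rStar (d : Inlet) (γ : ℝ) : ℝ := Real.sqrt (γ * d.κ₂ ^ 2 / ((γ - 1) * d.B₀ γ))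

/-- `f₂(ρ)`, for the exit circle `r = r₁` and the exit pressure `pex`. -/
def f₂ (d : Inlet) (γ r₁ pex ρ : ℝ) : ℝ :=
  γ * pex / (γ - 1) * ρ - (d.B₀ γ - d.κ₂ ^ 2 / (2 * r₁ ^ 2)) * ρ ^ 2 + d.κ₁ ^ 2 / (2 * r₁ ^ 2)

/-- `ρ^♯ = γ (γ + 1) pex / (2 (γ - 1) B₀)`. -/
def ρSharp (d : Inlet) (γ pex : ℝ) : ℝ := γ * (γ + 1) * pex / (2 * (γ - 1) * d.B₀ γ)

/-- `r` is a threshold radius: `r > r_*` and `f₁(r) = 1` along the smooth, radially supersonic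
flow with the prescribed data at `r₀`. That flow is continued from `r₀` to `r`, outwards
if `r > r₀` and inwards if `r < r₀`. -/
def IsThreshold (d : Inlet) (γ r : ℝ) : Prop :=
  d.rStar γ < r ∧ ∃ w : RadialFlow,
    w.IsEulerOn γ (min d.r₀ r) (max d.r₀ r) ∧ d.Matches w ∧
    (∀ s ∈ Icc (min d.r₀ r) (max d.r₀ r), w.soundSpeed γ s < w.U₁ s) ∧
    d.f₁ γ w r = 1

end Inlet

/-- `(wm, wp)` is a radially symmetric shock solution in `r₀ < r < r₁` with shock circle `r = rb`,
the given incoming flow at `r₀` and exit pressure `pex` at `r₁`: the Euler system holds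
on both sides, and the Rankine-Hugoniot conditions and the entropy condition `[p] > 0` hold
on the shock. -/
structure IsShockSolution (d : Inlet) (γ r₁ pex rb : ℝ) (wm wp : RadialFlow) : Prop where
  location : rb ∈ Ioo d.r₀ r₁
  euler_minus : wm.IsEulerOn γ d.r₀ rb
  euler_plus : wp.IsEulerOn γ rb r₁
  entrance : d.Matches wm
  exit_pressure : wp.pressure γ r₁ = pex
  rh_mass : wp.ρ rb * wp.U₁ rb = wm.ρ rb * wm.U₁ rb
  rh_radial : wp.ρ rb * wp.U₁ rb ^ 2 + wp.pressure γ rb =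
    wm.ρ rb * wm.U₁ rb ^ 2 + wm.pressure γ rb
  rh_angular : wp.ρ rb * wp.U₁ rb * wp.U₂ rb = wm.ρ rb * wm.U₁ rb * wm.U₂ rb
  rh_bernoulli : wp.bernoulli γ rb = wm.bernoulli γ rb
  entropy_condition : wm.pressure γ rb < wp.pressure γ rb

/-- The state is supersonic on both sides of the shock. -/
def IsSupersonicSupersonicShock (γ rb : ℝ) (wm wp : RadialFlow) : Prop :=
  1 < wm.machSq γ rb ∧ 1 < wp.machSq γ rb

/-- The state is supersonic ahead of the shock and subsonic behind it. -/
def IsSupersonicSubsonicShock (γ rb : ℝ) (wm wp : RadialFlow) : Prop :=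
  1 < wm.machSq γ rb ∧ wp.machSq γ rb < 1

/-- The state is supersonic ahead of the shock and sonic behind it. -/
def IsSupersonicSonicShock (γ rb : ℝ) (wm wp : RadialFlow) : Prop :=
  1 < wm.machSq γ rb ∧ wp.machSq γ rb = 1

/-- The three patterns behind a supersonic-supersonic shock, selected by the sign of
`f₂(ρ^♯)`: the flow is supersonic up to the exit; it changes from supersonic to subsonic
across a sonic circle `r = rc` inside the annulus; or it is supersonic and becomes sonic exactly
at the exit. -/
def SupersonicShockPatterns (d : Inlet) (γ r₁ pex rb : ℝ) (wm wp : RadialFlow) : Prop :=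
  (0 < d.f₂ γ r₁ pex (d.ρSharp γ pex) →
    IsSupersonicSupersonicShock γ rb wm wp ∧ ∀ r ∈ Icc rb r₁, 1 < wp.machSq γ r) ∧
  (d.f₂ γ r₁ pex (d.ρSharp γ pex) < 0 →
    IsSupersonicSupersonicShock γ rb wm wp ∧ ∃ rc ∈ Ioo rb r₁,
      (∀ r ∈ Ico rb rc, 1 < wp.machSq γ r) ∧ wp.machSq γ rc = 1 ∧
      ∀ r ∈ Ioc rc r₁, wp.machSq γ r < 1) ∧
  (d.f₂ γ r₁ pex (d.ρSharp γ pex) = 0 →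
    IsSupersonicSupersonicShock γ rb wm wp ∧
      (∀ r ∈ Ico rb r₁, 1 < wp.machSq γ r) ∧ wp.machSq γ r₁ = 1)

end

/-! The Euler system integrates completely: `r ρ U₁`, `r U₂`, `A` and `B` are constant in every
classical flow. With `h(r) = B₀ - κ₂²/(2r²)`, `k = (γ+1)/(γ-1)` and the normalized ratio `x = k
U₁²/(2h)`, equal to 1 exactly where `U₁ = c`, what remains is one scalar equation `A = S(r) Ψ(x)`
(`A_eq`). Here `Ψ(x) = (k - x) x^((γ-1)/2)` rises on `[0,1]` and falls on `[1,k]`, and `S` increases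
with `r`. Hence there is one radially subsonic and one radially supersonic branch. Going outwards,
`Ψ(x) = A/S` moves away from its maximum: no flow that starts off `x = 1` reaches it, the supersonic
branch accelerates and the subsonic one decelerates.

Across a shock the ratio is inverted, `x⁺ = 1/x⁻` (Prandtl's relation, `velocityRatio_eq_inv`), and
the entropy function is multiplied by `Ψ(1/x⁻)/Ψ(x⁻)`, which increases with `x⁻`
(`shockEntropyRatio_strictMonoOn`). Moving the shock outwards therefore raises `x⁻`, then the
entropy behind the shock, then the exit ratio, and so lowers the exit pressure. Thus the exit
pressure is a continuous strictly decreasing function of the shock radius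
(`exitPressure_strictAntiOn`); inverting it gives existence, uniqueness and (A).

For (B), `|M|² > 1` means `(1 - x) h r² < κ₂²/(γ-1)`. Behind a fixed shock the left side increases
with `r` (`sonicGap_lt`), so the flow passes at most once through the sonic state, from supersonic
to subsonic. Just behind the shock it equals `(1 - 1/x⁻) h r²`, which increases with the shock
radius (`shockGap_lt`) and takes the sonic value only at the threshold `r'_*`. At the exit,
`f₂(ρ^♯)` is a positive multiple of `|M|² - 1` (`f₂_ρSharp_eq`). -/

/-- A function which is locally inverted on the open set `s`, and injective there, has a smooth
inverse. -/
theorem contDiffAt_invFunOn {f : ℝ → ℝ} {s : Set ℝ} {n : WithTop ℕ∞} (hs : IsOpen s)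
    (hinj : InjOn f s) {x f' : ℝ} (hx : x ∈ s) (hf : ContDiffAt ℝ n f x)
    (hf' : HasDerivAt f f' x) (h0 : f' ≠ 0) (hn : n ≠ 0) :
    ContDiffAt ℝ n (Function.invFunOn f s) (f x) := by
  have hF : HasFDerivAt f ((ContinuousLinearEquiv.unitsEquivAut ℝ (Units.mk0 f' h0) :
      ℝ ≃L[ℝ] ℝ) : ℝ →L[ℝ] ℝ) x := by
    convert! hf'.hasFDerivAt using 1
  have hloc := hf.to_localInverse hF hn
  have hval := hf.localInverse_apply_image hF hn
  have hright : ∀ᶠ y in 𝓝 (f x), f (hf.localInverse hF hn y) = y :=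
    (hf.hasStrictFDerivAt' hF hn).eventually_right_inverse
  refine hloc.congr_of_eventuallyEq ?_
  -- Near `f x` the local inverse stays in `s`, where injectivity identifies it with `invFunOn`.
  have hmem : ∀ᶠ y in 𝓝 (f x), hf.localInverse hF hn y ∈ s :=
    hloc.continuousAt.eventually (by rw [hval]; exact hs.mem_nhds hx)
  filter_upwards [hright, hmem] with y hy hys
  have hex : ∃ a ∈ s, f a = y := ⟨_, hys, hy⟩
  exact hinj (Function.invFunOn_mem hex) hys ((Function.invFunOn_eq hex).trans hy.symm)

/-! ### The entropy profile and its two inverses -/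

noncomputable section

/-- Square of the ratio of the limiting velocity to the critical velocity. -/
def limitRatio (γ : ℝ) : ℝ := (γ + 1) / (γ - 1)

/-- Up to constants, the entropy function of a flow with prescribed mass flux and enthalpy,
in terms of the squared ratio `x` of the velocity to the critical velocity. -/
def entropyProfile (γ x : ℝ) : ℝ := (limitRatio γ - x) * x ^ ((γ - 1) / 2)

/-- The subcritical inverse of the entropy profile. -/
def subRatio (γ : ℝ) : ℝ → ℝ := Function.invFunOn (entropyProfile γ) (Ioo 0 1)

/-- The supercritical inverse of the entropy profile. -/
def superRatio (γ : ℝ) : ℝ → ℝ := Function.invFunOn (entropyProfile γ) (Ioo 1 (limitRatio γ))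

end

section Profile

variable {γ : ℝ}

theorem one_lt_limitRatio (hγ : 1 < γ) : 1 < limitRatio γ := by
  rw [limitRatio, lt_div_iff₀ (by linarith)]; linarith

theorem limitRatio_mul (hγ : 1 < γ) : limitRatio γ * (γ - 1) = γ + 1 := by
  rw [limitRatio, div_mul_cancel₀ _ (by linarith : (γ - 1) ≠ 0)]

/-- The two terms of the product rule combine through `k (γ - 1) = γ + 1` into a multiple of `1 -
x`, so `x = 1` is the only critical point on the positive axis. -/
theorem hasDerivAt_entropyProfile (hγ : 1 < γ) {x : ℝ} (hx : 0 < x) :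
    HasDerivAt (entropyProfile γ)
      (x ^ ((γ - 1) / 2) * ((γ + 1) / 2) * (1 - x) / x) x := by
  have h1 : HasDerivAt (fun y : ℝ => y ^ ((γ - 1) / 2))
      ((γ - 1) / 2 * x ^ ((γ - 1) / 2 - 1)) x :=
    Real.hasDerivAt_rpow_const (Or.inl hx.ne')
  have h2 := ((hasDerivAt_const x (limitRatio γ)).sub (hasDerivAt_id x)).mul h1
  convert! h2 using 1
  simp only [Pi.sub_apply, id]
  rw [Real.rpow_sub_one hx.ne']
  field_simp
  linear_combination (-1 : ℝ) * limitRatio_mul hγ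

theorem contDiffAt_entropyProfile {x : ℝ} (hx : 0 < x) : ContDiffAt ℝ ∞ (entropyProfile γ) x :=
  (contDiffAt_const.sub contDiffAt_id).mul (contDiffAt_id.rpow_const_of_ne hx.ne')

theorem continuous_entropyProfile (hγ : 1 < γ) : Continuous (entropyProfile γ) :=
  (continuous_const.sub continuous_id).mul
    (Real.continuous_rpow_const (by linarith))

theorem entropyProfile_strictMonoOn (hγ : 1 < γ) :
    StrictMonoOn (entropyProfile γ) (Icc 0 1) := by
  refine strictMonoOn_of_deriv_pos (convex_Icc _ _) (continuous_entropyProfile hγ).continuousOn ?_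
  intro x hx
  rw [interior_Icc] at hx
  rw [(hasDerivAt_entropyProfile hγ hx.1).deriv]
  have := Real.rpow_pos_of_pos hx.1 ((γ - 1) / 2)
  have := hx.1
  have : 0 < 1 - x := by linarith [hx.2]
  positivity

theorem entropyProfile_strictAntiOn (hγ : 1 < γ) :
    StrictAntiOn (entropyProfile γ) (Ici 1) := by
  refine strictAntiOn_of_deriv_neg (convex_Ici _) (continuous_entropyProfile hγ).continuousOn ?_
  intro x hx
  rw [interior_Ici, mem_Ioi] at hx
  have hx0 : 0 < x := by linarith
  rw [(hasDerivAt_entropyProfile hγ hx0).deriv]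
  have := Real.rpow_pos_of_pos hx0 ((γ - 1) / 2)
  have h1 : 0 < x - 1 := by linarith
  have : 0 < x ^ ((γ - 1) / 2) * ((γ + 1) / 2) * (x - 1) / x := by positivity
  have e : x ^ ((γ - 1) / 2) * ((γ + 1) / 2) * (1 - x) / x =
    -(x ^ ((γ - 1) / 2) * ((γ + 1) / 2) * (x - 1) / x) := by ring
  linarith

theorem entropyProfile_pos {x : ℝ} (hx : x ∈ Ioo 0 (limitRatio γ)) : 0 < entropyProfile γ x :=
  mul_pos (sub_pos.2 hx.2) (Real.rpow_pos_of_pos hx.1 _)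

theorem entropyProfile_zero (hγ : 1 < γ) : entropyProfile γ 0 = 0 := by
  rw [entropyProfile, Real.zero_rpow (by linarith), mul_zero]

theorem entropyProfile_limitRatio : entropyProfile γ (limitRatio γ) = 0 := by
  rw [entropyProfile, sub_self, zero_mul]

theorem entropyProfile_lt_one (hγ : 1 < γ) {x : ℝ} (hx : 0 < x) (h1 : x ≠ 1) :
    entropyProfile γ x < entropyProfile γ 1 := by
  rcases lt_or_gt_of_ne h1 with h | h
  · exact entropyProfile_strictMonoOn hγ ⟨hx.le, h.le⟩ (right_mem_Icc.2 zero_le_one) h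
  · exact entropyProfile_strictAntiOn hγ (mem_Ici.2 le_rfl) (mem_Ici.2 h.le) h

theorem exists_subRatio (hγ : 1 < γ) {y : ℝ} (hy : y ∈ Ioo 0 (entropyProfile γ 1)) :
    ∃ x ∈ Ioo 0 1, entropyProfile γ x = y := by
  rw [← entropyProfile_zero hγ] at hy
  exact intermediate_value_Ioo zero_le_one (continuous_entropyProfile hγ).continuousOn hy

theorem exists_superRatio (hγ : 1 < γ) {y : ℝ} (hy : y ∈ Ioo 0 (entropyProfile γ 1)) :
    ∃ x ∈ Ioo 1 (limitRatio γ), entropyProfile γ x = y := by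
  rw [← entropyProfile_limitRatio] at hy
  exact intermediate_value_Ioo' (one_lt_limitRatio hγ).le
    (continuous_entropyProfile hγ).continuousOn hy

theorem subRatio_mem (hγ : 1 < γ) {y : ℝ} (hy : y ∈ Ioo 0 (entropyProfile γ 1)) :
    subRatio γ y ∈ Ioo (0 : ℝ) 1 := Function.invFunOn_mem (exists_subRatio hγ hy)

theorem entropyProfile_subRatio (hγ : 1 < γ) {y : ℝ} (hy : y ∈ Ioo 0 (entropyProfile γ 1)) :
    entropyProfile γ (subRatio γ y) = y := Function.invFunOn_eq (exists_subRatio hγ hy)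

theorem superRatio_mem (hγ : 1 < γ) {y : ℝ} (hy : y ∈ Ioo 0 (entropyProfile γ 1)) :
    superRatio γ y ∈ Ioo 1 (limitRatio γ) := Function.invFunOn_mem (exists_superRatio hγ hy)

theorem entropyProfile_superRatio (hγ : 1 < γ) {y : ℝ} (hy : y ∈ Ioo 0 (entropyProfile γ 1)) :
    entropyProfile γ (superRatio γ y) = y := Function.invFunOn_eq (exists_superRatio hγ hy)

theorem injOn_entropyProfile_sub (hγ : 1 < γ) : InjOn (entropyProfile γ) (Ioo 0 1) :=
  (entropyProfile_strictMonoOn hγ).injOn.mono Ioo_subset_Icc_self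

theorem injOn_entropyProfile_super (hγ : 1 < γ) :
    InjOn (entropyProfile γ) (Ioo 1 (limitRatio γ)) :=
  (entropyProfile_strictAntiOn hγ).injOn.mono fun _ hx => hx.1.le

theorem eq_subRatio (hγ : 1 < γ) {x : ℝ} (hx : x ∈ Ioo (0 : ℝ) 1) :
    subRatio γ (entropyProfile γ x) = x :=
  injOn_entropyProfile_sub hγ (Function.invFunOn_mem ⟨x, hx, rfl⟩) hx
    (Function.invFunOn_eq ⟨x, hx, rfl⟩)

theorem eq_superRatio (hγ : 1 < γ) {x : ℝ} (hx : x ∈ Ioo 1 (limitRatio γ)) :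
    superRatio γ (entropyProfile γ x) = x :=
  injOn_entropyProfile_super hγ (Function.invFunOn_mem ⟨x, hx, rfl⟩) hx
    (Function.invFunOn_eq ⟨x, hx, rfl⟩)

theorem contDiffAt_subRatio (hγ : 1 < γ) {y : ℝ} (hy : y ∈ Ioo 0 (entropyProfile γ 1)) :
    ContDiffAt ℝ ∞ (subRatio γ) y := by
  obtain ⟨x, hx, rfl⟩ := exists_subRatio hγ hy
  refine contDiffAt_invFunOn isOpen_Ioo (injOn_entropyProfile_sub hγ) hx
    (contDiffAt_entropyProfile hx.1) (hasDerivAt_entropyProfile hγ hx.1) ?_ (by simp)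
  have := Real.rpow_pos_of_pos hx.1 ((γ - 1) / 2)
  have := hx.1
  have : 0 < 1 - x := by linarith [hx.2]
  positivity

theorem contDiffAt_superRatio (hγ : 1 < γ) {y : ℝ} (hy : y ∈ Ioo 0 (entropyProfile γ 1)) :
    ContDiffAt ℝ ∞ (superRatio γ) y := by
  obtain ⟨x, hx, rfl⟩ := exists_superRatio hγ hy
  have hx0 : 0 < x := by linarith [hx.1]
  refine contDiffAt_invFunOn isOpen_Ioo (injOn_entropyProfile_super hγ) hx
    (contDiffAt_entropyProfile hx0) (hasDerivAt_entropyProfile hγ hx0) ?_ (by simp)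
  have h1 := Real.rpow_pos_of_pos hx0 ((γ - 1) / 2)
  have h2 : 1 - x ≠ 0 := by linarith [hx.1]
  have h3 : (γ + 1) / 2 ≠ 0 := by linarith
  exact div_ne_zero (mul_ne_zero (mul_ne_zero h1.ne' h3) h2) hx0.ne'

theorem subRatio_strictMonoOn (hγ : 1 < γ) :
    StrictMonoOn (subRatio γ) (Ioo 0 (entropyProfile γ 1)) := by
  intro a ha b hb hab
  rw [← entropyProfile_subRatio hγ ha, ← entropyProfile_subRatio hγ hb] at hab
  exact ((entropyProfile_strictMonoOn hγ).lt_iff_lt (Ioo_subset_Icc_self (subRatio_mem hγ ha))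
    (Ioo_subset_Icc_self (subRatio_mem hγ hb))).1 hab

theorem superRatio_strictAntiOn (hγ : 1 < γ) :
    StrictAntiOn (superRatio γ) (Ioo 0 (entropyProfile γ 1)) := by
  intro a ha b hb hab
  rw [← entropyProfile_superRatio hγ ha, ← entropyProfile_superRatio hγ hb] at hab
  exact ((entropyProfile_strictAntiOn hγ).lt_iff_gt (superRatio_mem hγ ha).1.le
    (superRatio_mem hγ hb).1.le).1 hab

/-- The entropy jump across a normal shock increases with the strength of the shock. -/
theorem shockEntropyRatio_strictMonoOn (hγ : 1 < γ) :
    StrictMonoOn (fun x => entropyProfile γ x⁻¹ / entropyProfile γ x)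
      (Ioo 1 (limitRatio γ)) := by
  set k := limitRatio γ with hk
  have hk1 : 1 < k := one_lt_limitRatio hγ
  have hkγ : k * (γ - 1) = γ + 1 := limitRatio_mul hγ
  -- The ratio equals `(k x - 1) / ((k - x) x^γ)`; its logarithm has a rational derivative.
  have key : StrictMonoOn (fun x => Real.log (k * x - 1) - Real.log (k - x) - γ * Real.log x)
      (Ioo 1 k) := by
    have hd : ∀ x ∈ Ioo 1 k, HasDerivAt
        (fun x => Real.log (k * x - 1) - Real.log (k - x) - γ * Real.log x)
        (k * 1 / (k * x - 1) - (0 - 1) / (k - x) - γ * x⁻¹) x := by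
      intro x hx
      have hx0 : 0 < x := by linarith [hx.1]
      have h1 : k * x - 1 ≠ 0 := by nlinarith [hx.1]
      have h2 : k - x ≠ 0 := by linarith [hx.2]
      exact ((((hasDerivAt_id x).const_mul k).sub_const 1).log h1 |>.sub
        (((hasDerivAt_const x k).sub (hasDerivAt_id x)).log h2)).sub
        ((Real.hasDerivAt_log hx0.ne').const_mul γ)
    refine strictMonoOn_of_deriv_pos (convex_Ioo _ _)
      (fun x hx => (hd x hx).continuousAt.continuousWithinAt) ?_
    intro x hx
    rw [interior_Ioo] at hx
    rw [(hd x hx).deriv]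
    have hx0 : 0 < x := by linarith [hx.1]
    have h1 : 0 < k * x - 1 := by nlinarith [hx.1]
    have h2 : 0 < k - x := by linarith [hx.2]
    have hγ1 : 0 < γ - 1 := by linarith
    have h3 : 0 < x - 1 := by linarith [hx.1]
    have hγk : γ = (k + 1) / (k - 1) := by
      rw [eq_div_iff (by linarith)]; linarith
    -- Once `γ` is expressed by `k`, the numerator is a multiple of `(x - 1)²`. The double zero at
    -- `x = 1` reflects that a weak shock changes the entropy only to third order.
    have e : k * 1 / (k * x - 1) - (0 - 1) / (k - x) - γ * x⁻¹ =
        (k + 1) / (k - 1) * k * (x - 1) ^ 2 / ((k * x - 1) * (k - x) * x) := by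
      rw [hγk]
      have : k - 1 ≠ 0 := by linarith
      field_simp
      ring
    rw [e]
    have : 0 < k - 1 := by linarith
    have : 0 < k := by linarith
    positivity
  have heq : EqOn (fun x => Real.exp
      (Real.log (k * x - 1) - Real.log (k - x) - γ * Real.log x))
      (fun x => entropyProfile γ x⁻¹ / entropyProfile γ x) (Ioo 1 k) := by
    intro x hx
    have hx0 : 0 < x := by linarith [hx.1]
    have h1 : 0 < k * x - 1 := by nlinarith [hx.1]
    have h2 : 0 < k - x := by linarith [hx.2]
    simp only [entropyProfile, ← hk]
    rw [Real.exp_sub, Real.exp_sub, Real.exp_log h1, Real.exp_log h2, mul_comm γ,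
      ← Real.rpow_def_of_pos hx0, Real.inv_rpow hx0.le]
    have e : x ^ γ = x * (x ^ ((γ - 1) / 2) * x ^ ((γ - 1) / 2)) := by
      rw [← Real.rpow_add hx0, ← Real.rpow_one_add' hx0.le (by linarith)]
      congr 1
      ring
    rw [e]
    have := Real.rpow_pos_of_pos hx0 ((γ - 1) / 2)
    field_simp
  exact (Real.exp_strictMono.comp_strictMonoOn key).congr heq

end Profile

/-! ### Reduced variables: enthalpy, entropy scale, velocity ratio -/

noncomputable section

namespace Inlet

/-- Enthalpy available to the radial motion, `B₀ - κ₂² / (2 r²)`. -/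
def enthalpy (d : Inlet) (γ r : ℝ) : ℝ := d.B₀ γ - d.κ₂ ^ 2 / (2 * r ^ 2)

/-- The factor relating the entropy function to the entropy profile at the radius `r`. -/
def entropyScale (d : Inlet) (γ r : ℝ) : ℝ :=
  (γ - 1) / γ / limitRatio γ * (2 / limitRatio γ) ^ ((γ - 1) / 2) / d.κ₁ ^ (γ - 1) *
    (d.enthalpy γ r ^ ((γ + 1) / 2) * r ^ (γ - 1))

/-- The exit pressure at the radius `r` of a flow with velocity ratio `x`. -/
def ratioPressure (d : Inlet) (γ r x : ℝ) : ℝ :=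
  (γ - 1) / γ * (d.κ₁ / (r * √(2 * d.enthalpy γ r * x / limitRatio γ))) *
    (d.enthalpy γ r * (1 - x / limitRatio γ))

/-- The flow with the constants of the inlet, entropy function `A` and velocity ratio `x`. -/
def ratioFlow (d : Inlet) (γ A : ℝ) (x : ℝ → ℝ) : RadialFlow where
  ρ r := d.κ₁ / (r * √(2 * d.enthalpy γ r * x r / limitRatio γ))
  U₁ r := √(2 * d.enthalpy γ r * x r / limitRatio γ)
  U₂ r := d.κ₂ / r
  A _ := A

end Inlet

namespace RadialFlow

/-- The state of `w` at the radius `r` has the mass flux, the angular momentum and the Bernoulli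
constant of the inlet `d`. -/
structure HasInvariants (w : RadialFlow) (d : Inlet) (γ r : ℝ) : Prop where
  ρ_pos : 0 < w.ρ r
  A_pos : 0 < w.A r
  mass : r * (w.ρ r * w.U₁ r) = d.κ₁
  angular : r * w.U₂ r = d.κ₂
  bernoulli : w.bernoulli γ r = d.B₀ γ

/-- Squared ratio of the radial velocity to its critical value. -/
def velocityRatio (w : RadialFlow) (d : Inlet) (γ r : ℝ) : ℝ :=
  limitRatio γ * w.U₁ r ^ 2 / (2 * d.enthalpy γ r)

end RadialFlow

end

namespace Inlet

variable {d : Inlet} {γ : ℝ}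

theorem Admissible.U₁₀_pos (hd : d.Admissible γ) : 0 < d.U₁₀ :=
  (Real.sqrt_nonneg _).trans_lt hd.supersonic

theorem Admissible.κ₁_pos (hd : d.Admissible γ) : 0 < d.κ₁ :=
  mul_pos (mul_pos hd.r₀_pos hd.ρ₀_pos) hd.U₁₀_pos

theorem Admissible.κ₂_sq_pos (hd : d.Admissible γ) : 0 < d.κ₂ ^ 2 :=
  sq_pos_of_ne_zero (mul_ne_zero hd.r₀_pos.ne' hd.angular)

theorem Admissible.B₀_pos (hd : d.Admissible γ) (hγ : 1 < γ) : 0 < d.B₀ γ := by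
  have h1 := hd.U₁₀_pos
  have h2 := hd.A₀_pos
  have h3 := Real.rpow_pos_of_pos hd.ρ₀_pos (γ - 1)
  have h4 : 0 < γ - 1 := by linarith
  have h5 : 0 < γ := by linarith
  rw [B₀]
  positivity

theorem enthalpy_strictMonoOn (hd : d.Admissible γ) :
    StrictMonoOn (d.enthalpy γ) (Ioi 0) := by
  intro a ha b hb hab
  have ha : 0 < a := ha
  have := hd.κ₂_sq_pos
  unfold enthalpy
  gcongr

theorem contDiffAt_enthalpy {r : ℝ} (hr : 0 < r) : ContDiffAt ℝ ∞ (d.enthalpy γ) r :=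
  contDiffAt_const.sub (contDiffAt_const.div (contDiffAt_const.mul (contDiffAt_id.pow 2))
    (by positivity))

theorem entropyScale_const_pos (hγ : 1 < γ) (hd : d.Admissible γ) :
    0 < (γ - 1) / γ / limitRatio γ * (2 / limitRatio γ) ^ ((γ - 1) / 2) / d.κ₁ ^ (γ - 1) := by
  have h1 := hd.κ₁_pos
  have h2 : 0 < limitRatio γ := by linarith [one_lt_limitRatio hγ]
  have h4 : 0 < γ - 1 := by linarith
  have h5 : 0 < γ := by linarith
  positivity

theorem entropyScale_pos (hγ : 1 < γ) (hd : d.Admissible γ) {r : ℝ} (hr : 0 < r)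
    (hh : 0 < d.enthalpy γ r) : 0 < d.entropyScale γ r :=
  mul_pos (entropyScale_const_pos hγ hd)
    (mul_pos (Real.rpow_pos_of_pos hh _) (Real.rpow_pos_of_pos hr _))

/-- This monotonicity drives the whole proof: the scale is a positive multiple of a product of
positive powers of `h` and `r`, both increasing. It is why a flow moves away from criticality
outwards. -/
theorem entropyScale_lt (hγ : 1 < γ) (hd : d.Admissible γ) {a b : ℝ} (ha : 0 < a)
    (hh : 0 < d.enthalpy γ a) (hab : a < b) : d.entropyScale γ a < d.entropyScale γ b := by
  have h := enthalpy_strictMonoOn hd ha (ha.trans hab) hab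
  have h4 : 0 < γ - 1 := by linarith
  have h5 : 0 < (γ + 1) / 2 := by linarith
  have := entropyScale_const_pos hγ hd
  have := Real.rpow_pos_of_pos hh ((γ + 1) / 2)
  have := Real.rpow_pos_of_pos (ha.trans hab) (γ - 1)
  unfold entropyScale
  gcongr

theorem contDiffAt_entropyScale {r : ℝ} (hr : 0 < r) (hh : 0 < d.enthalpy γ r) :
    ContDiffAt ℝ ∞ (d.entropyScale γ) r :=
  contDiffAt_const.mul (((contDiffAt_enthalpy hr).rpow_const_of_ne hh.ne').mul
    (contDiffAt_id.rpow_const_of_ne hr.ne'))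

theorem continuousOn_entropyScale (hγ : 1 < γ) : ContinuousOn (d.entropyScale γ) (Ioi 0) := by
  have h1 : ContinuousOn (d.enthalpy γ) (Ioi 0) := fun r hr =>
    (contDiffAt_enthalpy hr).continuousAt.continuousWithinAt
  exact continuousOn_const.mul ((h1.rpow_const fun _ _ => Or.inr (by linarith)).mul
    (continuousOn_id.rpow_const fun _ _ => Or.inr (by linarith)))

/-- Both sides are `c²/γ = A ρ^(γ-1)`, with `ρ = κ₁/(r u)` on the left and Bernoulli's law on the
right; this fixes the constants in `entropyScale`. No flow is mentioned, so that it serves both to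
analyse a given flow and to construct one. -/
theorem entropyScale_mul_entropyProfile (hγ : 1 < γ) (hd : d.Admissible γ) {r u x : ℝ}
    (hr : 0 < r) (hu : 0 < u) (hh : 0 < d.enthalpy γ r) (hx : 0 < x)
    (hux : u ^ 2 = 2 * d.enthalpy γ r * x / limitRatio γ) :
    d.entropyScale γ r * entropyProfile γ x * (d.κ₁ / (r * u)) ^ (γ - 1) =
      (γ - 1) / γ * (d.enthalpy γ r * (1 - x / limitRatio γ)) := by
  have hκ := hd.κ₁_pos
  have hk : 0 < limitRatio γ := by linarith [one_lt_limitRatio hγ]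
  have e1 : u ^ (γ - 1) = (2 / limitRatio γ) ^ ((γ - 1) / 2) *
      d.enthalpy γ r ^ ((γ - 1) / 2) * x ^ ((γ - 1) / 2) := by
    rw [← Real.mul_rpow (by positivity) hh.le, ← Real.mul_rpow (by positivity) hx.le,
      show 2 / limitRatio γ * d.enthalpy γ r * x = u ^ (2 : ℝ) by
        rw [Real.rpow_two, hux]; ring, ← Real.rpow_mul hu.le]
    congr 1
    ring
  have e2 : d.enthalpy γ r ^ ((γ + 1) / 2) = d.enthalpy γ r * d.enthalpy γ r ^ ((γ - 1) / 2) := by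
    rw [← Real.rpow_one_add' hh.le (by linarith)]
    congr 1
    ring
  rw [Real.div_rpow hκ.le (by positivity), Real.mul_rpow hr.le hu.le, e1, entropyScale, e2,
    entropyProfile]
  have := Real.rpow_pos_of_pos hκ (γ - 1)
  have := Real.rpow_pos_of_pos hr (γ - 1)
  have := Real.rpow_pos_of_pos hx ((γ - 1) / 2)
  have := Real.rpow_pos_of_pos hh ((γ - 1) / 2)
  have : 0 < (2 / limitRatio γ) ^ ((γ - 1) / 2) := by positivity
  have : 0 < γ := by linarith
  field_simp

end Inlet

/-! ### Algebra of a single state with the invariants of the inlet -/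

namespace RadialFlow.HasInvariants

variable {w : RadialFlow} {d : Inlet} {γ r : ℝ}

theorem U₁_pos (hw : w.HasInvariants d γ r) (hd : d.Admissible γ) (hr : 0 < r) : 0 < w.U₁ r := by
  have h := hw.mass
  have h1 := hd.κ₁_pos
  rw [← h] at h1
  exact (pos_iff_pos_of_mul_pos (pos_of_mul_pos_right h1 hr.le |> fun h => h)).1 hw.ρ_pos

theorem U₂_eq (hw : w.HasInvariants d γ r) (hr : 0 < r) : w.U₂ r = d.κ₂ / r := by
  rw [← hw.angular]; field_simp

theorem pressure_pos (hw : w.HasInvariants d γ r) : 0 < w.pressure γ r :=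
  mul_pos hw.A_pos (Real.rpow_pos_of_pos hw.ρ_pos _)

theorem soundSpeed_sq (hw : w.HasInvariants d γ r) (hγ : 1 < γ) :
    w.soundSpeed γ r ^ 2 = γ * w.pressure γ r / w.ρ r :=
  Real.sq_sqrt (div_nonneg (mul_nonneg (by linarith) hw.pressure_pos.le) hw.ρ_pos.le)

theorem soundSpeed_pos (hw : w.HasInvariants d γ r) (hγ : 1 < γ) : 0 < w.soundSpeed γ r :=
  Real.sqrt_pos.2 (div_pos (mul_pos (by linarith) hw.pressure_pos) hw.ρ_pos)

theorem enthalpy_eq (hw : w.HasInvariants d γ r) (hγ : 1 < γ) (hr : 0 < r) :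
    d.enthalpy γ r = w.U₁ r ^ 2 / 2 + w.soundSpeed γ r ^ 2 / (γ - 1) := by
  rw [Inlet.enthalpy, ← hw.bernoulli, ← hw.angular, RadialFlow.bernoulli, hw.soundSpeed_sq hγ]
  have := hw.ρ_pos
  have : γ - 1 ≠ 0 := by linarith
  field_simp
  ring

theorem enthalpy_pos (hw : w.HasInvariants d γ r) (hγ : 1 < γ) (hr : 0 < r) :
    0 < d.enthalpy γ r := by
  rw [hw.enthalpy_eq hγ hr]
  have := hw.soundSpeed_pos hγ
  have : 0 < γ - 1 := by linarith
  positivity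

theorem U₁_sq (hw : w.HasInvariants d γ r) (hγ : 1 < γ) (hr : 0 < r) :
    w.U₁ r ^ 2 = 2 * d.enthalpy γ r * w.velocityRatio d γ r / limitRatio γ := by
  have := hw.enthalpy_pos hγ hr
  have := one_lt_limitRatio hγ
  rw [velocityRatio]
  field_simp

theorem soundSpeed_sq_eq (hw : w.HasInvariants d γ r) (hγ : 1 < γ) (hr : 0 < r) :
    w.soundSpeed γ r ^ 2 =
      (γ - 1) * d.enthalpy γ r * (1 - w.velocityRatio d γ r / limitRatio γ) := by
  have h1 := hw.enthalpy_eq hγ hr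
  have h2 := hw.U₁_sq hγ hr
  have h3 : γ - 1 ≠ 0 := by linarith
  rw [h2] at h1
  have := one_lt_limitRatio hγ
  field_simp at h1
  field_simp
  linear_combination -h1

theorem velocityRatio_mem (hw : w.HasInvariants d γ r) (hγ : 1 < γ) (hd : d.Admissible γ)
    (hr : 0 < r) : w.velocityRatio d γ r ∈ Ioo 0 (limitRatio γ) := by
  have hh := hw.enthalpy_pos hγ hr
  have hk := one_lt_limitRatio hγ
  constructor
  · have := hw.U₁_pos hd hr
    rw [velocityRatio]
    positivity
  · have h1 := hw.soundSpeed_sq_eq hγ hr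
    have h2 := pow_pos (hw.soundSpeed_pos hγ) 2
    rw [h1] at h2
    have h3 := pos_of_mul_pos_right h2 (mul_nonneg (by linarith) hh.le)
    rw [sub_pos, div_lt_one (by linarith)] at h3
    exact h3

theorem ρ_eq (hw : w.HasInvariants d γ r) (hd : d.Admissible γ) (hr : 0 < r) :
    w.ρ r = d.κ₁ / (r * w.U₁ r) := by
  have := hw.U₁_pos hd hr
  rw [← hw.mass]
  field_simp

theorem soundSpeed_sq_eq_A (hw : w.HasInvariants d γ r) (hγ : 1 < γ) :
    w.soundSpeed γ r ^ 2 = γ * (w.A r * w.ρ r ^ (γ - 1)) := by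
  rw [hw.soundSpeed_sq hγ, pressure, Real.rpow_sub_one hw.ρ_pos.ne']
  ring

/-- This is the scalar equation to which the Euler system reduces: given the entropy, it determines
the velocity ratio up to the choice of branch. -/
theorem A_eq (hw : w.HasInvariants d γ r) (hγ : 1 < γ) (hd : d.Admissible γ) (hr : 0 < r) :
    w.A r = d.entropyScale γ r * entropyProfile γ (w.velocityRatio d γ r) := by
  have h1 := Inlet.entropyScale_mul_entropyProfile hγ hd hr (hw.U₁_pos hd hr)
    (hw.enthalpy_pos hγ hr) (hw.velocityRatio_mem hγ hd hr).1 (hw.U₁_sq hγ hr)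
  rw [← hw.ρ_eq hd hr] at h1
  have h2 := hw.soundSpeed_sq_eq_A hγ
  rw [hw.soundSpeed_sq_eq hγ hr] at h2
  have h3 := Real.rpow_pos_of_pos hw.ρ_pos (γ - 1)
  have h4 : 0 < γ := by linarith
  refine mul_right_cancel₀ h3.ne' (mul_left_cancel₀ h4.ne' ?_)
  rw [← h2, h1]
  field_simp

/-- By Bernoulli's law `U₁² - c²` is a positive multiple of `x - 1`. -/
theorem soundSpeed_lt_iff (hw : w.HasInvariants d γ r) (hγ : 1 < γ) (hd : d.Admissible γ)
    (hr : 0 < r) : w.soundSpeed γ r < w.U₁ r ↔ 1 < w.velocityRatio d γ r := by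
  rw [← sq_lt_sq₀ (hw.soundSpeed_pos hγ).le (hw.U₁_pos hd hr).le, hw.soundSpeed_sq_eq hγ hr,
    hw.U₁_sq hγ hr]
  have hk := one_lt_limitRatio hγ
  have e : 2 * d.enthalpy γ r * w.velocityRatio d γ r / limitRatio γ -
      (γ - 1) * d.enthalpy γ r * (1 - w.velocityRatio d γ r / limitRatio γ) =
      (γ + 1) / limitRatio γ * d.enthalpy γ r * (w.velocityRatio d γ r - 1) := by
    field_simp
    linear_combination -d.enthalpy γ r * limitRatio_mul hγ
  have h0 : 0 < (γ + 1) / limitRatio γ * d.enthalpy γ r :=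
    mul_pos (div_pos (by linarith) (by linarith)) (hw.enthalpy_pos hγ hr)
  rw [← sub_pos, e, mul_pos_iff_of_pos_left h0, sub_pos]

theorem lt_soundSpeed_iff (hw : w.HasInvariants d γ r) (hγ : 1 < γ) (hd : d.Admissible γ)
    (hr : 0 < r) : w.U₁ r < w.soundSpeed γ r ↔ w.velocityRatio d γ r < 1 := by
  rw [← sq_lt_sq₀ (hw.U₁_pos hd hr).le (hw.soundSpeed_pos hγ).le, hw.soundSpeed_sq_eq hγ hr,
    hw.U₁_sq hγ hr]
  have hk := one_lt_limitRatio hγ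
  have e : (γ - 1) * d.enthalpy γ r * (1 - w.velocityRatio d γ r / limitRatio γ) -
      2 * d.enthalpy γ r * w.velocityRatio d γ r / limitRatio γ =
      (γ + 1) / limitRatio γ * d.enthalpy γ r * (1 - w.velocityRatio d γ r) := by
    field_simp
    linear_combination d.enthalpy γ r * limitRatio_mul hγ
  have h0 : 0 < (γ + 1) / limitRatio γ * d.enthalpy γ r :=
    mul_pos (div_pos (by linarith) (by linarith)) (hw.enthalpy_pos hγ hr)
  rw [← sub_pos, e, mul_pos_iff_of_pos_left h0, sub_pos]

/-- The excess of the speed over the speed of sound. -/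
theorem speed_sq_sub (hw : w.HasInvariants d γ r) (hγ : 1 < γ) (hr : 0 < r) :
    w.U₁ r ^ 2 + w.U₂ r ^ 2 - w.soundSpeed γ r ^ 2 =
      (γ - 1) / r ^ 2 * (d.κ₂ ^ 2 / (γ - 1) -
        (1 - w.velocityRatio d γ r) * (d.enthalpy γ r * r ^ 2)) := by
  rw [hw.U₂_eq hr, hw.U₁_sq hγ hr, hw.soundSpeed_sq_eq hγ hr]
  have hk := one_lt_limitRatio hγ
  have h1 : γ - 1 ≠ 0 := by linarith
  field_simp
  linear_combination (-d.enthalpy γ r * w.velocityRatio d γ r * r ^ 2) * limitRatio_mul hγ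

theorem one_lt_machSq_iff (hw : w.HasInvariants d γ r) (hγ : 1 < γ) (hr : 0 < r) :
    1 < w.machSq γ r ↔
      (1 - w.velocityRatio d γ r) * (d.enthalpy γ r * r ^ 2) < d.κ₂ ^ 2 / (γ - 1) := by
  have h0 : 0 < (γ - 1) / r ^ 2 := div_pos (by linarith) (by positivity)
  rw [machSq, one_lt_div (pow_pos (hw.soundSpeed_pos hγ) 2), ← sub_pos, hw.speed_sq_sub hγ hr,
    mul_pos_iff_of_pos_left h0, sub_pos]

theorem machSq_eq_one_iff (hw : w.HasInvariants d γ r) (hγ : 1 < γ) (hr : 0 < r) :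
    w.machSq γ r = 1 ↔
      (1 - w.velocityRatio d γ r) * (d.enthalpy γ r * r ^ 2) = d.κ₂ ^ 2 / (γ - 1) := by
  have h0 : 0 < (γ - 1) / r ^ 2 := div_pos (by linarith) (by positivity)
  rw [machSq, div_eq_one_iff_eq (pow_pos (hw.soundSpeed_pos hγ) 2).ne', ← sub_eq_zero,
    hw.speed_sq_sub hγ hr, mul_eq_zero, or_iff_right h0.ne', sub_eq_zero, eq_comm]

theorem machSq_lt_one_iff (hw : w.HasInvariants d γ r) (hγ : 1 < γ) (hr : 0 < r) :
    w.machSq γ r < 1 ↔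
      d.κ₂ ^ 2 / (γ - 1) < (1 - w.velocityRatio d γ r) * (d.enthalpy γ r * r ^ 2) := by
  rw [← not_le, le_iff_lt_or_eq, eq_comm, hw.one_lt_machSq_iff hγ hr, hw.machSq_eq_one_iff hγ hr,
    ← le_iff_lt_or_eq, not_le]

/-- `f₁ = 1` exactly where the state behind a normal shock is sonic. -/
theorem f₁_eq_one_iff (hw : w.HasInvariants d γ r) (hγ : 1 < γ) (hd : d.Admissible γ)
    (hr : 0 < r) : d.f₁ γ w r = 1 ↔
      (1 - (w.velocityRatio d γ r)⁻¹) * (d.enthalpy γ r * r ^ 2) = d.κ₂ ^ 2 / (γ - 1) := by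
  have hk := one_lt_limitRatio hγ
  have hγ1 : γ - 1 ≠ 0 := by linarith
  have hγ2 : γ + 1 ≠ 0 := by linarith
  have hh := hw.enthalpy_pos hγ hr
  have hx := hw.velocityRatio_mem hγ hd hr
  -- The denominator in `f₁` is `2h/k`, the square of the critical radial speed.
  have hden : 2 * (γ - 1) / (γ + 1) * d.B₀ γ - (γ - 1) / (γ + 1) * w.U₂ r ^ 2 =
      2 * d.enthalpy γ r / limitRatio γ := by
    rw [hw.U₂_eq hr, Inlet.enthalpy, limitRatio]
    field_simp
  rw [Inlet.f₁, hden, hw.U₁_sq hγ hr, hw.soundSpeed_sq_eq hγ hr, hw.U₂_eq hr]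
  have h1 : limitRatio γ - w.velocityRatio d γ r ≠ 0 := by linarith [hx.2]
  have h2 := hx.1
  have hkγ := limitRatio_mul hγ
  generalize w.velocityRatio d γ r = x at *
  generalize d.enthalpy γ r = h at *
  have hg : γ - 1 = 2 / (limitRatio γ - 1) := by
    rw [eq_div_iff (by linarith)]; linarith
  generalize limitRatio γ = k at *
  have hk1 : k - 1 ≠ 0 := by linarith
  rw [hg]
  rw [← sub_eq_zero, ← sub_eq_zero (a := (1 - x⁻¹) * (h * r ^ 2))]
  have e : (1 - (d.κ₂ / r) ^ 2 / (2 * h / k)) *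
      (2 * h * x / k / (2 / (k - 1) * h * (1 - x / k))) - 1 =
      (k * x / ((k - x) * h * r ^ 2)) * ((1 - x⁻¹) * (h * r ^ 2) - d.κ₂ ^ 2 / (2 / (k - 1))) := by
    have : 1 - x / k ≠ 0 := by
      rw [sub_ne_zero, ne_comm, Ne, div_eq_one_iff_eq (by linarith)]
      exact fun h => h1 (by linarith)
    field_simp
    ring
  rw [e, mul_eq_zero, or_iff_right]
  have : k ≠ 0 := by linarith
  positivity

theorem pressure_eq (hw : w.HasInvariants d γ r) (hγ : 1 < γ) (hd : d.Admissible γ)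
    (hr : 0 < r) : w.pressure γ r = d.ratioPressure γ r (w.velocityRatio d γ r) := by
  have h1 := hw.soundSpeed_sq hγ
  rw [hw.soundSpeed_sq_eq hγ hr] at h1
  rw [Inlet.ratioPressure, ← hw.U₁_sq hγ hr, Real.sqrt_sq (hw.U₁_pos hd hr).le, ← hw.ρ_eq hd hr]
  have := hw.ρ_pos
  have : γ ≠ 0 := by linarith
  field_simp at h1 ⊢
  linarith

/-- States with the same invariants, entropy and velocity ratio coincide. -/
theorem eq_of_velocityRatio_eq {v : RadialFlow} (hw : w.HasInvariants d γ r)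
    (hv : v.HasInvariants d γ r) (hγ : 1 < γ) (hd : d.Admissible γ) (hr : 0 < r)
    (h : w.velocityRatio d γ r = v.velocityRatio d γ r) :
    w.ρ r = v.ρ r ∧ w.U₁ r = v.U₁ r ∧ w.U₂ r = v.U₂ r ∧ w.A r = v.A r := by
  have hU : w.U₁ r = v.U₁ r := by
    rw [← sq_eq_sq₀ (hw.U₁_pos hd hr).le (hv.U₁_pos hd hr).le, hw.U₁_sq hγ hr, hv.U₁_sq hγ hr, h]
  refine ⟨?_, hU, ?_, ?_⟩
  · rw [hw.ρ_eq hd hr, hv.ρ_eq hd hr, hU]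
  · rw [hw.U₂_eq hr, hv.U₂_eq hr]
  · rw [hw.A_eq hγ hd hr, hv.A_eq hγ hd hr, h]

end RadialFlow.HasInvariants

namespace Inlet

variable {d : Inlet} {γ r : ℝ}

theorem ratioFlow_hasInvariants (hγ : 1 < γ) (hd : d.Admissible γ) (hr : 0 < r)
    (hh : 0 < d.enthalpy γ r) {A : ℝ} {x : ℝ → ℝ} (hx : x r ∈ Ioo 0 (limitRatio γ))
    (hA : d.entropyScale γ r * entropyProfile γ (x r) = A) :
    (d.ratioFlow γ A x).HasInvariants d γ r := by
  have hκ := hd.κ₁_pos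
  have hk := one_lt_limitRatio hγ
  have hx0 := hx.1
  have hu : 0 < √(2 * d.enthalpy γ r * x r / limitRatio γ) := Real.sqrt_pos.2 (by positivity)
  have hρ : 0 < (d.ratioFlow γ A x).ρ r := div_pos hκ (mul_pos hr hu)
  have hu2 : √(2 * d.enthalpy γ r * x r / limitRatio γ) ^ 2 =
      2 * d.enthalpy γ r * x r / limitRatio γ := Real.sq_sqrt (by positivity)
  refine ⟨hρ, ?_, ?_, ?_, ?_⟩
  · rw [ratioFlow, ← hA]
    exact mul_pos (entropyScale_pos hγ hd hr hh) (entropyProfile_pos hx)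
  · simp only [ratioFlow]
    field_simp
  · simp only [ratioFlow]
    field_simp
  · have h1 := entropyScale_mul_entropyProfile hγ hd hr hu hh hx.1 hu2
    rw [hA] at h1
    have h2 : γ * (d.ratioFlow γ A x).pressure γ r / ((γ - 1) * (d.ratioFlow γ A x).ρ r) =
        γ / (γ - 1) * (A * (d.κ₁ / (r * √(2 * d.enthalpy γ r * x r / limitRatio γ))) ^ (γ - 1)) := by
      change γ * (A * (d.κ₁ / (r * √(2 * d.enthalpy γ r * x r / limitRatio γ))) ^ γ) /
        ((γ - 1) * (d.κ₁ / (r * √(2 * d.enthalpy γ r * x r / limitRatio γ)))) = _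
      rw [Real.rpow_sub_one (div_pos hκ (mul_pos hr hu)).ne', mul_div_mul_comm, mul_div_assoc A]
    rw [RadialFlow.bernoulli, h2, h1]
    simp only [ratioFlow]
    rw [hu2, enthalpy]
    have : γ - 1 ≠ 0 := by linarith
    have : γ ≠ 0 := by linarith
    have : limitRatio γ ≠ 0 := by linarith
    field_simp
    ring

theorem velocityRatio_ratioFlow (hγ : 1 < γ) (hh : 0 < d.enthalpy γ r) {A : ℝ} {x : ℝ → ℝ}
    (hx : 0 < x r) : (d.ratioFlow γ A x).velocityRatio d γ r = x r := by
  have hk := one_lt_limitRatio hγ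
  rw [RadialFlow.velocityRatio]
  simp only [ratioFlow]
  rw [Real.sq_sqrt (by positivity)]
  field_simp

/-- The pressure is the density times `c²/γ`, and both factors decrease as the velocity ratio grows.
-/
theorem ratioPressure_strictAntiOn (hγ : 1 < γ) (hd : d.Admissible γ) (hr : 0 < r)
    (hh : 0 < d.enthalpy γ r) :
    StrictAntiOn (d.ratioPressure γ r) (Ioo 0 (limitRatio γ)) := by
  intro a ha b hb hab
  have hκ := hd.κ₁_pos
  have hk := one_lt_limitRatio hγ
  have ha0 := ha.1
  have h1 : 0 < γ - 1 := by linarith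
  have h2 : 0 < γ := by linarith
  have hu : 0 < √(2 * d.enthalpy γ r * a / limitRatio γ) := Real.sqrt_pos.2 (by positivity)
  have hlt : √(2 * d.enthalpy γ r * a / limitRatio γ) < √(2 * d.enthalpy γ r * b / limitRatio γ) :=
    Real.sqrt_lt_sqrt (by positivity) (by gcongr)
  have hb1 : 0 < 1 - b / limitRatio γ := by
    rw [sub_pos, div_lt_one (by linarith)]; exact hb.2
  unfold ratioPressure
  gcongr

theorem continuousOn_ratioPressure (hγ : 1 < γ) (hr : 0 < r) (hh : 0 < d.enthalpy γ r) :
    ContinuousOn (d.ratioPressure γ r) (Ioi 0) := by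
  have hk := one_lt_limitRatio hγ
  have hne : ∀ x ∈ Ioi (0 : ℝ), r * √(2 * d.enthalpy γ r * x / limitRatio γ) ≠ 0 := by
    intro x hx
    have hx : 0 < x := hx
    have : 0 < √(2 * d.enthalpy γ r * x / limitRatio γ) := Real.sqrt_pos.2 (by positivity)
    positivity
  refine (continuousOn_const.mul (continuousOn_const.div ?_ hne)).mul ?_ <;> fun_prop

end Inlet

/-! ### Conservation laws of classical flows -/

theorem eq_of_deriv_eq_zero_of_mem_Icc {f : ℝ → ℝ} {a b : ℝ} (hc : ContinuousOn f (Icc a b))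
    (hd : ∀ r ∈ Ioo a b, HasDerivAt f 0 r) {x y : ℝ} (hx : x ∈ Icc a b) (hy : y ∈ Icc a b) :
    f x = f y := by
  have hdiff : DifferentiableOn ℝ f (interior (Icc a b)) := by
    rw [interior_Icc]
    exact fun r hr => (hd r hr).differentiableAt.differentiableWithinAt
  have h0 : ∀ r ∈ interior (Icc a b), deriv f r = 0 := by
    rw [interior_Icc]
    exact fun r hr => (hd r hr).deriv
  have hm := monotoneOn_of_deriv_nonneg (convex_Icc a b) hc hdiff fun r hr => (h0 r hr).ge
  have ha := antitoneOn_of_deriv_nonpos (convex_Icc a b) hc hdiff fun r hr => (h0 r hr).le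
  rcases le_total x y with h | h
  · exact le_antisymm (hm hx hy h) (ha hx hy h)
  · exact le_antisymm (ha hy hx h) (hm hy hx h)

namespace RadialFlow

variable {w : RadialFlow} {d : Inlet} {γ r a b : ℝ}

theorem hasDerivAt_pressure {ρ' A' : ℝ} (hρ : HasDerivAt w.ρ ρ' r) (hA : HasDerivAt w.A A' r)
    (h0 : 0 < w.ρ r) :
    HasDerivAt (w.pressure γ) (A' * w.ρ r ^ γ + γ * w.pressure γ r * ρ' / w.ρ r) r := by
  convert! hA.mul (hρ.rpow_const (p := γ) (Or.inl h0.ne')) using 1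
  rw [Real.rpow_sub_one h0.ne', pressure]
  ring

theorem hasDerivAt_bernoulli {ρ' U₁' U₂' p' : ℝ} (hρ : HasDerivAt w.ρ ρ' r)
    (hU₁ : HasDerivAt w.U₁ U₁' r) (hU₂ : HasDerivAt w.U₂ U₂' r)
    (hp : HasDerivAt (w.pressure γ) p' r) (h0 : 0 < w.ρ r) (hγ : 1 < γ) :
    HasDerivAt (w.bernoulli γ) (w.U₁ r * U₁' + w.U₂ r * U₂' +
      γ / (γ - 1) * (p' / w.ρ r - w.pressure γ r * ρ' / w.ρ r ^ 2)) r := by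
  have h1 : γ - 1 ≠ 0 := by linarith
  have hne : (γ - 1) * w.ρ r ≠ 0 := mul_ne_zero h1 h0.ne'
  convert! (((hU₁.pow 2).add (hU₂.pow 2)).div_const 2).add
    ((hp.const_mul γ).div (hρ.const_mul (γ - 1)) hne) using 1
  field_simp
  ring

namespace IsEulerOn

theorem hasDerivAt {f : ℝ → ℝ} (hf : ContDiffOn ℝ 1 f (Ioo a b)) (hr : r ∈ Ioo a b) :
    HasDerivAt f (deriv f r) r :=
  ((hf.contDiffAt (isOpen_Ioo.mem_nhds hr)).differentiableAt (by simp)).hasDerivAt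

theorem continuousOn_pressure (hw : w.IsEulerOn γ a b) :
    ContinuousOn (w.pressure γ) (Icc a b) :=
  hw.cont_A.mul (hw.cont_ρ.rpow_const fun _ hr => Or.inl (hw.ρ_pos _ hr).ne')

/-- The mass flux, the angular momentum, the entropy function and the Bernoulli function are
constant in a classical flow. -/
theorem hasInvariants (hw : w.IsEulerOn γ a b) (hγ : 1 < γ) (hd : d.Admissible γ) (ha : 0 < a)
    {s : ℝ} (hs : s ∈ Icc a b) (h : w.HasInvariants d γ s) (hr : r ∈ Icc a b) :
    w.HasInvariants d γ r ∧ w.A r = w.A s := by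
  have hmass : ∀ t ∈ Icc a b, t * (w.ρ t * w.U₁ t) = d.κ₁ := by
    intro t ht
    rw [← h.mass]
    refine eq_of_deriv_eq_zero_of_mem_Icc (f := fun t => t * (w.ρ t * w.U₁ t))
      (continuousOn_id.mul (hw.cont_ρ.mul hw.cont_U₁)) ?_ ht hs
    intro q hq
    have hq0 : q ≠ 0 := (ha.trans hq.1).ne'
    have h1 := (hasDerivAt hw.diff_ρ hq).mul (hasDerivAt hw.diff_U₁ hq)
    have h2 := hw.mass q hq
    rw [show (fun s => w.ρ s * w.U₁ s) = w.ρ * w.U₁ from rfl, h1.deriv] at h2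
    convert! (hasDerivAt_id q).mul h1 using 1
    simp only [id, Pi.mul_apply]
    field_simp at h2
    linear_combination -h2
  have hU : ∀ t ∈ Icc a b, w.U₁ t ≠ 0 := by
    intro t ht h0
    have := hmass t ht
    rw [h0, mul_zero, mul_zero] at this
    exact hd.κ₁_pos.ne this
  have hang' : ∀ q ∈ Ioo a b, q * deriv w.U₂ q = -w.U₂ q := by
    intro q hq
    have hq0 : q ≠ 0 := (ha.trans hq.1).ne'
    have h2 := hw.angular_momentum q hq
    refine mul_left_cancel₀ (hU q (Ioo_subset_Icc_self hq)) ?_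
    have h3 : w.U₁ q * deriv w.U₂ q * q + w.U₁ q * w.U₂ q = 0 := by
      rw [← zero_mul q, ← h2]
      field_simp
    linear_combination h3
  have hang : ∀ t ∈ Icc a b, t * w.U₂ t = d.κ₂ := by
    intro t ht
    rw [← h.angular]
    refine eq_of_deriv_eq_zero_of_mem_Icc (f := fun t => t * w.U₂ t)
      (continuousOn_id.mul hw.cont_U₂) ?_ ht hs
    intro q hq
    convert! (hasDerivAt_id q).mul (hasDerivAt hw.diff_U₂ hq) using 1
    simp only [id]
    linear_combination -hang' q hq
  -- The positive mass flux keeps `U₁` from vanishing, so it can be cancelled from the equation.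
  have hA' : ∀ q ∈ Ioo a b, deriv w.A q = 0 := fun q hq =>
    (mul_eq_zero.1 (hw.entropy q hq)).resolve_left (hU q (Ioo_subset_Icc_self hq))
  have hA : ∀ t ∈ Icc a b, w.A t = w.A s := fun t ht =>
    eq_of_deriv_eq_zero_of_mem_Icc hw.cont_A
      (fun q hq => hA' q hq ▸ hasDerivAt hw.diff_A hq) ht hs
  have hγ1 : γ - 1 ≠ 0 := by linarith
  have hB : ∀ t ∈ Icc a b, w.bernoulli γ t = d.B₀ γ := by
    intro t ht
    rw [← h.bernoulli]
    refine eq_of_deriv_eq_zero_of_mem_Icc (f := w.bernoulli γ)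
      ((((hw.cont_U₁.pow 2).add (hw.cont_U₂.pow 2)).div_const 2).add
        ((continuousOn_const.mul hw.continuousOn_pressure).div
          (continuousOn_const.mul hw.cont_ρ)
          fun q hq => mul_ne_zero hγ1 (hw.ρ_pos q hq).ne')) ?_ ht hs
    intro q hq
    have hq0 : q ≠ 0 := (ha.trans hq.1).ne'
    have hqI := Ioo_subset_Icc_self hq
    have hρ := hw.ρ_pos q hqI
    have hp := hasDerivAt_pressure (γ := γ) (hasDerivAt hw.diff_ρ hq) (hasDerivAt hw.diff_A hq) hρ
    have h1 := hw.radial_momentum q hq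
    rw [hA' q hq, zero_mul, zero_add] at hp
    rw [hp.deriv] at h1
    convert! hasDerivAt_bernoulli (hasDerivAt hw.diff_ρ hq) (hasDerivAt hw.diff_U₁ hq)
      (hasDerivAt hw.diff_U₂ hq) hp hρ hγ using 1
    have h4 : deriv w.U₂ q = - w.U₂ q / q := by
      rw [eq_div_iff hq0, mul_comm, hang' q hq]
    rw [h4]
    -- For constant entropy `γ/(γ-1) (p/ρ)' = p'/ρ`, so the radial momentum equation says `B' = 0`.
    have h5 : γ / (γ - 1) * (γ * w.pressure γ q * deriv w.ρ q / w.ρ q / w.ρ q -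
        w.pressure γ q * deriv w.ρ q / w.ρ q ^ 2) =
        1 / w.ρ q * (γ * w.pressure γ q * deriv w.ρ q / w.ρ q) := by
      field_simp
    rw [h5, ← h1]
    ring
  exact ⟨⟨hw.ρ_pos r hr, hw.A_pos r hr, hmass r hr, hang r hr, hB r hr⟩, hA r hr⟩

theorem continuousOn_velocityRatio (hw : w.IsEulerOn γ a b)
    (hh : ∀ r ∈ Icc a b, 0 < d.enthalpy γ r) (ha : 0 < a) :
    ContinuousOn (w.velocityRatio d γ) (Icc a b) :=
  (continuousOn_const.mul (hw.cont_U₁.pow 2)).div (continuousOn_const.mul fun _ hr =>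
    (Inlet.contDiffAt_enthalpy (ha.trans_le hr.1)).continuousAt.continuousWithinAt)
    fun r hr => (mul_pos two_pos (hh r hr)).ne'

/-- A flow which is not critical at its inner circle is nowhere critical. -/
theorem velocityRatio_ne_one (hw : w.IsEulerOn γ a b) (hγ : 1 < γ) (hd : d.Admissible γ)
    (ha : 0 < a) (h : w.HasInvariants d γ a) (h1 : w.velocityRatio d γ a ≠ 1)
    (hr : r ∈ Icc a b) : w.velocityRatio d γ r ≠ 1 := by
  intro hr1
  have haI : a ∈ Icc a b := ⟨le_rfl, hr.1.trans hr.2⟩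
  obtain ⟨hi, hAr⟩ := hw.hasInvariants hγ hd ha haI h hr
  have hr0 := ha.trans_le hr.1
  -- At a critical radius `S(a) Ψ(x(a)) = S(r) Ψ(1)`, although `S(a) ≤ S(r)` and `Ψ(x(a)) < Ψ(1)`.
  rw [hi.A_eq hγ hd hr0, h.A_eq hγ hd ha, hr1] at hAr
  have h2 : entropyProfile γ (w.velocityRatio d γ a) < entropyProfile γ 1 :=
    entropyProfile_lt_one hγ (h.velocityRatio_mem hγ hd ha).1 h1
  have h3 : d.entropyScale γ a ≤ d.entropyScale γ r := by
    rcases hr.1.eq_or_lt with e | e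
    · rw [e]
    · exact (Inlet.entropyScale_lt hγ hd ha (h.enthalpy_pos hγ ha) e).le
  have h4 := Inlet.entropyScale_pos hγ hd ha (h.enthalpy_pos hγ ha)
  have h5 := entropyProfile_pos (h.velocityRatio_mem hγ hd ha)
  nlinarith

theorem velocityRatio_lt_one (hw : w.IsEulerOn γ a b) (hγ : 1 < γ) (hd : d.Admissible γ)
    (ha : 0 < a) (h : w.HasInvariants d γ a) (h1 : w.velocityRatio d γ a < 1)
    (hr : r ∈ Icc a b) : w.velocityRatio d γ r < 1 := by
  by_contra! hcon
  have haI : a ∈ Icc a b := ⟨le_rfl, hr.1.trans hr.2⟩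
  have hc := hw.continuousOn_velocityRatio (d := d) (fun q hq =>
    (hw.hasInvariants hγ hd ha haI h hq).1.enthalpy_pos hγ (ha.trans_le hq.1)) ha
  obtain ⟨q, hq, hq1⟩ := intermediate_value_Icc hr.1 (hc.mono (Icc_subset_Icc_right hr.2))
    (show (1 : ℝ) ∈ _ from ⟨h1.le, hcon⟩)
  exact hw.velocityRatio_ne_one hγ hd ha h h1.ne ⟨hq.1, hq.2.trans hr.2⟩ hq1

theorem one_lt_velocityRatio (hw : w.IsEulerOn γ a b) (hγ : 1 < γ) (hd : d.Admissible γ)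
    (ha : 0 < a) (h : w.HasInvariants d γ a) (h1 : 1 < w.velocityRatio d γ a)
    (hr : r ∈ Icc a b) : 1 < w.velocityRatio d γ r := by
  by_contra! hcon
  have haI : a ∈ Icc a b := ⟨le_rfl, hr.1.trans hr.2⟩
  have hc := hw.continuousOn_velocityRatio (d := d) (fun q hq =>
    (hw.hasInvariants hγ hd ha haI h hq).1.enthalpy_pos hγ (ha.trans_le hq.1)) ha
  obtain ⟨q, hq, hq1⟩ := intermediate_value_Icc' hr.1 (hc.mono (Icc_subset_Icc_right hr.2))
    (show (1 : ℝ) ∈ _ from ⟨hcon, h1.le⟩)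
  exact hw.velocityRatio_ne_one hγ hd ha h h1.ne' ⟨hq.1, hq.2.trans hr.2⟩ hq1

end IsEulerOn

end RadialFlow

/-! ### From a velocity ratio back to a flow -/

namespace Inlet

variable {d : Inlet} {γ a b A : ℝ} {x : ℝ → ℝ}

/-- A smooth solution of the algebraic equation for the velocity ratio gives a smooth flow. -/
theorem contDiffAt_ratioFlow (hγ : 1 < γ) (ha : 0 < a)
    (hh : ∀ r ∈ Icc a b, 0 < d.enthalpy γ r) (hx : ∀ r ∈ Icc a b, x r ∈ Ioo 0 (limitRatio γ))
    (hs : ∀ r ∈ Icc a b, ContDiffAt ℝ ∞ x r) {r : ℝ} (hr : r ∈ Icc a b) :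
    ContDiffAt ℝ ∞ (d.ratioFlow γ A x).ρ r ∧ ContDiffAt ℝ ∞ (d.ratioFlow γ A x).U₁ r ∧
    ContDiffAt ℝ ∞ (d.ratioFlow γ A x).U₂ r ∧ ContDiffAt ℝ ∞ (d.ratioFlow γ A x).A r := by
  have hr0 := ha.trans_le hr.1
  have hk := one_lt_limitRatio hγ
  have h0 : 0 < 2 * d.enthalpy γ r * x r / limitRatio γ := by
    have := hh r hr
    have := (hx r hr).1
    positivity
  have hU : ContDiffAt ℝ ∞ (d.ratioFlow γ A x).U₁ r :=
    (((contDiffAt_const.mul (contDiffAt_enthalpy hr0)).mul (hs r hr)).div_const _).sqrt h0.ne'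
  refine ⟨contDiffAt_const.div (contDiffAt_id.mul hU)
    (mul_ne_zero hr0.ne' (Real.sqrt_pos.2 h0).ne'), hU,
    contDiffAt_const.div contDiffAt_id hr0.ne', contDiffAt_const⟩

/-- The differential equations come from differentiating the four invariants, which hold identically
on the interval; the derivative of `x` is never computed. -/
theorem ratioFlow_isEulerOn (hγ : 1 < γ) (hd : d.Admissible γ) (ha : 0 < a)
    (hh : ∀ r ∈ Icc a b, 0 < d.enthalpy γ r) (hx : ∀ r ∈ Icc a b, x r ∈ Ioo 0 (limitRatio γ))
    (hA : ∀ r ∈ Icc a b, d.entropyScale γ r * entropyProfile γ (x r) = A)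
    (hs : ∀ r ∈ Icc a b, ContDiffAt ℝ ∞ x r) : (d.ratioFlow γ A x).IsEulerOn γ a b := by
  have hsm := fun r hr => contDiffAt_ratioFlow (A := A) hγ ha hh hx hs (r := r) hr
  have hinv := fun r (hr : r ∈ Icc a b) =>
    ratioFlow_hasInvariants hγ hd (ha.trans_le hr.1) (hh r hr) (hx r hr) (hA r hr)
  have hAc : (d.ratioFlow γ A x).A = fun _ => A := rfl
  -- From here on only smoothness, the invariants and the constancy of `A` matter, not the formulas.
  generalize d.ratioFlow γ A x = w at *
  have hmem : ∀ r ∈ Ioo a b, ∀ᶠ q in 𝓝 r, q ∈ Icc a b := fun r hr =>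
    mem_of_superset (isOpen_Ioo.mem_nhds hr) Ioo_subset_Icc_self
  have hder : ∀ {r}, r ∈ Ioo a b → HasDerivAt w.ρ (deriv w.ρ r) r ∧
      HasDerivAt w.U₁ (deriv w.U₁ r) r ∧ HasDerivAt w.U₂ (deriv w.U₂ r) r := fun hr =>
    have h := hsm _ (Ioo_subset_Icc_self hr)
    ⟨(h.1.differentiableAt (by simp)).hasDerivAt, (h.2.1.differentiableAt (by simp)).hasDerivAt,
      (h.2.2.1.differentiableAt (by simp)).hasDerivAt⟩
  have hang : ∀ q ∈ Ioo a b, q * deriv w.U₂ q = -w.U₂ q := by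
    intro q hq
    have h2 : HasDerivAt (fun t => t * w.U₂ t) 0 q :=
      (hasDerivAt_const q d.κ₂).congr_of_eventuallyEq
        ((hmem q hq).mono fun t ht => (hinv t ht).angular)
    have h3 := h2.unique ((hasDerivAt_id q).mul (hder hq).2.2)
    simp only [id] at h3
    linear_combination -h3
  have hone : (1 : WithTop ℕ∞) ≤ ∞ := by exact_mod_cast le_top
  refine ⟨fun r hr => (hsm r hr).1.continuousAt.continuousWithinAt,
    fun r hr => (hsm r hr).2.1.continuousAt.continuousWithinAt,
    fun r hr => (hsm r hr).2.2.1.continuousAt.continuousWithinAt,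
    fun r hr => (hsm r hr).2.2.2.continuousAt.continuousWithinAt,
    fun r hr => ((hsm r (Ioo_subset_Icc_self hr)).1.of_le hone).contDiffWithinAt,
    fun r hr => ((hsm r (Ioo_subset_Icc_self hr)).2.1.of_le hone).contDiffWithinAt,
    fun r hr => ((hsm r (Ioo_subset_Icc_self hr)).2.2.1.of_le hone).contDiffWithinAt,
    fun r hr => ((hsm r (Ioo_subset_Icc_self hr)).2.2.2.of_le hone).contDiffWithinAt,
    fun r hr => (hinv r hr).ρ_pos, fun r hr => (hinv r hr).A_pos, ?_, ?_, ?_, ?_⟩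
  · intro q hq
    have hq0 : q ≠ 0 := (ha.trans hq.1).ne'
    have h1 := (hder hq).1.mul (hder hq).2.1
    have h2 : HasDerivAt (fun t => t * (w.ρ t * w.U₁ t)) 0 q :=
      (hasDerivAt_const q d.κ₁).congr_of_eventuallyEq
        ((hmem q hq).mono fun t ht => (hinv t ht).mass)
    have h3 := h2.unique ((hasDerivAt_id q).mul h1)
    rw [show (fun s => w.ρ s * w.U₁ s) = w.ρ * w.U₁ from rfl, h1.deriv]
    simp only [id] at h3
    field_simp
    linear_combination -h3
  · intro q hq
    have hq0 : q ≠ 0 := (ha.trans hq.1).ne'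
    have hρ := (hinv q (Ioo_subset_Icc_self hq)).ρ_pos
    have hγ1 : γ - 1 ≠ 0 := by linarith
    have hp := RadialFlow.hasDerivAt_pressure (γ := γ) (hder hq).1 (hAc ▸ hasDerivAt_const q A) hρ
    rw [zero_mul, zero_add] at hp
    have h1 := RadialFlow.hasDerivAt_bernoulli (hder hq).1 (hder hq).2.1 (hder hq).2.2 hp hρ hγ
    have h2 : HasDerivAt (w.bernoulli γ) 0 q :=
      (hasDerivAt_const q (d.B₀ γ)).congr_of_eventuallyEq
        ((hmem q hq).mono fun t ht => (hinv t ht).bernoulli)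
    have h3 := h2.unique h1
    have h4 : deriv w.U₂ q = -w.U₂ q / q := by
      rw [eq_div_iff hq0, mul_comm, hang q hq]
    have h5 : γ / (γ - 1) * (γ * w.pressure γ q * deriv w.ρ q / w.ρ q / w.ρ q -
        w.pressure γ q * deriv w.ρ q / w.ρ q ^ 2) =
        1 / w.ρ q * (γ * w.pressure γ q * deriv w.ρ q / w.ρ q) := by
      field_simp
    rw [h4, h5] at h3
    rw [hp.deriv, h3]
    ring
  · intro q hq
    have hq0 : q ≠ 0 := (ha.trans hq.1).ne'
    have h1 := hang q hq
    field_simp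
    linear_combination w.U₁ q * h1
  · intro q hq
    rw [hAc, deriv_const, mul_zero]

end Inlet

/-! ### Jump conditions and the meaning of `f₂(ρ^♯)` -/

namespace RadialFlow.HasInvariants

variable {w v : RadialFlow} {d : Inlet} {γ r : ℝ}

theorem pressure_eq_U₁ (hw : w.HasInvariants d γ r) (hγ : 1 < γ) (hd : d.Admissible γ)
    (hr : 0 < r) : w.pressure γ r =
      (γ - 1) / γ * (d.κ₁ / r) * (d.enthalpy γ r / w.U₁ r - w.U₁ r / 2) := by
  have hU := hw.U₁_pos hd hr
  have h1 := hw.enthalpy_eq hγ hr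
  rw [hw.soundSpeed_sq hγ] at h1
  have hρ := hw.ρ_pos
  have h2 : γ - 1 ≠ 0 := by linarith
  have h3 : γ ≠ 0 := by linarith
  rw [h1, ← hw.mass]
  field_simp
  ring

theorem momentum_eq (hw : w.HasInvariants d γ r) (hγ : 1 < γ) (hd : d.Admissible γ)
    (hr : 0 < r) : w.ρ r * w.U₁ r ^ 2 + w.pressure γ r =
      d.κ₁ / r / γ * ((γ + 1) / 2 * w.U₁ r + (γ - 1) * d.enthalpy γ r / w.U₁ r) := by
  have hU := hw.U₁_pos hd hr
  have h3 : γ ≠ 0 := by linarith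
  rw [hw.pressure_eq_U₁ hγ hd hr, hw.ρ_eq hd hr]
  field_simp
  ring

/-- The factorization separates the trivial solution of the jump condition from Prandtl's relation
`k U₁⁺ U₁⁻ = 2h`. -/
theorem momentum_sub (hw : w.HasInvariants d γ r) (hv : v.HasInvariants d γ r) (hγ : 1 < γ)
    (hd : d.Admissible γ) (hr : 0 < r) :
    (w.ρ r * w.U₁ r ^ 2 + w.pressure γ r) - (v.ρ r * v.U₁ r ^ 2 + v.pressure γ r) =
      d.κ₁ / r / γ * ((γ - 1) / (2 * (w.U₁ r * v.U₁ r))) * (w.U₁ r - v.U₁ r) *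
        (limitRatio γ * (w.U₁ r * v.U₁ r) - 2 * d.enthalpy γ r) := by
  have hU := hw.U₁_pos hd hr
  have hV := hv.U₁_pos hd hr
  have h3 : γ ≠ 0 := by linarith
  have h4 : γ - 1 ≠ 0 := by linarith
  rw [hw.momentum_eq hγ hd hr, hv.momentum_eq hγ hd hr, limitRatio]
  field_simp
  ring

theorem velocityRatio_mul (hw : w.HasInvariants d γ r) (hγ : 1 < γ) (hr : 0 < r) :
    w.velocityRatio d γ r * v.velocityRatio d γ r =
      (limitRatio γ * (w.U₁ r * v.U₁ r) / (2 * d.enthalpy γ r)) ^ 2 := by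
  have := hw.enthalpy_pos hγ hr
  rw [velocityRatio, velocityRatio]
  field_simp

/-- Across a normal shock the velocity ratio is inverted. -/
theorem velocityRatio_eq_inv (hw : w.HasInvariants d γ r) (hv : v.HasInvariants d γ r)
    (hγ : 1 < γ) (hd : d.Admissible γ) (hr : 0 < r)
    (hm : v.ρ r * v.U₁ r ^ 2 + v.pressure γ r = w.ρ r * w.U₁ r ^ 2 + w.pressure γ r)
    (hp : w.pressure γ r < v.pressure γ r) :
    v.velocityRatio d γ r = (w.velocityRatio d γ r)⁻¹ := by
  have hU := hw.U₁_pos hd hr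
  have hV := hv.U₁_pos hd hr
  have hh := hw.enthalpy_pos hγ hr
  have hκ := hd.κ₁_pos
  have h1 := hv.momentum_sub hw hγ hd hr
  rw [hm, sub_self, eq_comm, mul_eq_zero, mul_eq_zero] at h1
  have hγ0 : 0 < γ := by linarith
  have hγ1 : 0 < γ - 1 := by linarith
  have hpos : d.κ₁ / r / γ * ((γ - 1) / (2 * (v.U₁ r * w.U₁ r))) ≠ 0 := by positivity
  -- Given the invariants, the pressure is a function of `U₁`, so equal velocities would contradict
  -- the pressure jump.
  have hne : v.U₁ r - w.U₁ r ≠ 0 := by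
    intro h0
    have : v.U₁ r = w.U₁ r := by linarith
    rw [hw.pressure_eq_U₁ hγ hd hr, hv.pressure_eq_U₁ hγ hd hr, this] at hp
    exact hp.false
  have h2 := (h1.resolve_left (by simp [hpos, hne]))
  refine eq_inv_of_mul_eq_one_left ?_
  rw [hv.velocityRatio_mul hγ hr, sub_eq_zero.1 h2, div_self (by positivity), one_pow]

/-- Two states with inverse velocity ratios satisfy the jump conditions. -/
theorem jump_of_velocityRatio_eq_inv (hw : w.HasInvariants d γ r) (hv : v.HasInvariants d γ r)
    (hγ : 1 < γ) (hd : d.Admissible γ) (hr : 0 < r)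
    (h : v.velocityRatio d γ r = (w.velocityRatio d γ r)⁻¹) (h1 : 1 < w.velocityRatio d γ r) :
    v.ρ r * v.U₁ r ^ 2 + v.pressure γ r = w.ρ r * w.U₁ r ^ 2 + w.pressure γ r ∧
      w.pressure γ r < v.pressure γ r := by
  have hU := hw.U₁_pos hd hr
  have hV := hv.U₁_pos hd hr
  have hh := hw.enthalpy_pos hγ hr
  have hκ := hd.κ₁_pos
  have hk := one_lt_limitRatio hγ
  have hmom : v.ρ r * v.U₁ r ^ 2 + v.pressure γ r = w.ρ r * w.U₁ r ^ 2 + w.pressure γ r := by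
    have h2 := hv.velocityRatio_mul (v := w) hγ hr
    rw [h, inv_mul_cancel₀ (by linarith), eq_comm,
      pow_eq_one_iff_of_nonneg (by positivity) two_ne_zero, div_eq_one_iff_eq (by positivity)] at h2
    rw [← sub_eq_zero, hv.momentum_sub hw hγ hd hr, h2, sub_self, mul_zero]
  refine ⟨hmom, ?_⟩
  have hlt : v.velocityRatio d γ r < w.velocityRatio d γ r := by
    rw [h]
    exact (inv_lt_one_of_one_lt₀ h1).trans h1
  have hUV : v.U₁ r < w.U₁ r := by
    rw [← sq_lt_sq₀ hV.le hU.le, hw.U₁_sq hγ hr, hv.U₁_sq hγ hr]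
    gcongr
  -- The momentum flux `ρ U₁² = (κ₁/r) U₁` drops with the velocity, and the pressure makes up for
  -- it.
  have e1 : v.ρ r * v.U₁ r ^ 2 = d.κ₁ / r * v.U₁ r := by
    rw [hv.ρ_eq hd hr]; field_simp
  have e2 : w.ρ r * w.U₁ r ^ 2 = d.κ₁ / r * w.U₁ r := by
    rw [hw.ρ_eq hd hr]; field_simp
  have h3 : d.κ₁ / r * v.U₁ r < d.κ₁ / r * w.U₁ r := by gcongr
  linarith

/-- At the exit, `f₂(ρ^♯)` has the sign of `|M|² - 1`. -/
theorem f₂_ρSharp_eq (hw : w.HasInvariants d γ r) (hγ : 1 < γ) (hd : d.Admissible γ)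
    (hr : 0 < r) : ∃ c > 0, d.f₂ γ r (w.pressure γ r) (d.ρSharp γ (w.pressure γ r)) =
      c * (w.machSq γ r - 1) := by
  have hB := hd.B₀_pos hγ
  have hρ := hw.ρ_pos
  have hp := hw.pressure_pos (γ := γ)
  have hc := hw.soundSpeed_pos hγ
  have hU := hw.U₁_pos hd hr
  have hh := hw.enthalpy_pos hγ hr
  have hγ0 : 0 < γ := by linarith
  have hγ1 : 0 < γ - 1 := by linarith
  have hs : 0 < d.ρSharp γ (w.pressure γ r) := by rw [Inlet.ρSharp]; positivity
  refine ⟨(d.enthalpy γ r * d.ρSharp γ (w.pressure γ r) + w.ρ r * w.U₁ r ^ 2 / 2) *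
    (w.ρ r / (2 * d.B₀ γ) * w.soundSpeed γ r ^ 2), by positivity, ?_⟩
  have e1 : w.machSq γ r - 1 = (w.U₁ r ^ 2 + w.U₂ r ^ 2 - w.soundSpeed γ r ^ 2) /
      w.soundSpeed γ r ^ 2 := by
    rw [RadialFlow.machSq]; field_simp
  -- `ρ^♯` is the density of a sonic state with the given pressure and Bernoulli constant.
  have e2 : w.ρ r - d.ρSharp γ (w.pressure γ r) =
      w.ρ r / (2 * d.B₀ γ) * (w.U₁ r ^ 2 + w.U₂ r ^ 2 - w.soundSpeed γ r ^ 2) := by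
    rw [hw.soundSpeed_sq hγ, Inlet.ρSharp]
    have hb := hw.bernoulli
    rw [RadialFlow.bernoulli] at hb
    field_simp at hb ⊢
    linear_combination -hb
  -- The true density is a root of the quadratic `f₂`; the other factor is positive at positive
  -- arguments.
  have e3 : d.f₂ γ r (w.pressure γ r) (d.ρSharp γ (w.pressure γ r)) =
      (d.enthalpy γ r * d.ρSharp γ (w.pressure γ r) + w.ρ r * w.U₁ r ^ 2 / 2) *
      (w.ρ r - d.ρSharp γ (w.pressure γ r)) := by
    have h1 := hw.enthalpy_eq hγ hr
    rw [hw.soundSpeed_sq hγ] at h1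
    have h2 : γ * w.pressure γ r / (γ - 1) =
        w.ρ r * (d.enthalpy γ r - w.U₁ r ^ 2 / 2) := by
      rw [h1]; field_simp; ring
    have h3 : d.κ₁ ^ 2 / (2 * r ^ 2) = w.ρ r ^ 2 * w.U₁ r ^ 2 / 2 := by
      rw [← hw.mass]; field_simp
    rw [Inlet.f₂, h2, h3, ← Inlet.enthalpy]
    ring
  rw [e3, e2, e1]
  field_simp

end RadialFlow.HasInvariants

/-! ### The flow ahead of the shock and the flow behind it -/

namespace Inlet

noncomputable section

/-- The radii which the radially supersonic flow generated by the inlet reaches. -/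
structure Reaches (d : Inlet) (γ r : ℝ) : Prop where
  pos : 0 < r
  enthalpy_pos : 0 < d.enthalpy γ r
  lt : d.A₀ / d.entropyScale γ r < entropyProfile γ 1

/-- Velocity ratio of the radially supersonic flow generated by the inlet. -/
def inRatio (d : Inlet) (γ r : ℝ) : ℝ := superRatio γ (d.A₀ / d.entropyScale γ r)

/-- The radially supersonic flow generated by the inlet. -/
def inFlow (d : Inlet) (γ : ℝ) : RadialFlow := d.ratioFlow γ d.A₀ (d.inRatio γ)

/-- Entropy function behind a shock at the radius `r`. -/
def shockEntropy (d : Inlet) (γ r : ℝ) : ℝ :=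
  d.entropyScale γ r * entropyProfile γ (d.inRatio γ r)⁻¹

/-- Velocity ratio at the radius `r` of the flow behind a shock at the radius `b`. -/
def outRatio (d : Inlet) (γ b r : ℝ) : ℝ := subRatio γ (d.shockEntropy γ b / d.entropyScale γ r)

/-- The flow behind a shock at the radius `b`. -/
def outFlow (d : Inlet) (γ b : ℝ) : RadialFlow :=
  d.ratioFlow γ (d.shockEntropy γ b) (d.outRatio γ b)

/-- Excess of the flow behind a shock at the radius `b` over the sonic state. -/
def sonicGap (d : Inlet) (γ b r : ℝ) : ℝ := (1 - d.outRatio γ b r) * (d.enthalpy γ r * r ^ 2)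

/-- Excess of the state behind a shock at the radius `r` over the sonic state. -/
def shockGap (d : Inlet) (γ r : ℝ) : ℝ := (1 - (d.inRatio γ r)⁻¹) * (d.enthalpy γ r * r ^ 2)

end

variable {d : Inlet} {γ r b : ℝ}

theorem Matches.hasInvariants {w : RadialFlow} (hw : d.Matches w) (hγ : 1 < γ)
    (hd : d.Admissible γ) : w.HasInvariants d γ d.r₀ := by
  obtain ⟨h1, h2, h3, h4⟩ := hw
  refine ⟨h1 ▸ hd.ρ₀_pos, h4 ▸ hd.A₀_pos, ?_, ?_, ?_⟩
  · rw [h1, h2, κ₁, mul_assoc]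
  · rw [h3, κ₂]
  · rw [RadialFlow.bernoulli, RadialFlow.pressure, h1, h2, h3, h4, B₀,
      Real.rpow_sub_one hd.ρ₀_pos.ne']
    have := hd.ρ₀_pos
    have : γ - 1 ≠ 0 := by linarith
    field_simp

theorem Matches.one_lt_velocityRatio {w : RadialFlow} (hw : d.Matches w) (hγ : 1 < γ)
    (hd : d.Admissible γ) : 1 < w.velocityRatio d γ d.r₀ := by
  rw [← (hw.hasInvariants hγ hd).soundSpeed_lt_iff hγ hd hd.r₀_pos]
  obtain ⟨h1, h2, h3, h4⟩ := hw
  convert! hd.supersonic using 1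
  rw [RadialFlow.soundSpeed, RadialFlow.pressure, h1, h4, Real.rpow_sub_one hd.ρ₀_pos.ne']
  congr 1
  ring

/-- A radially supersonic state with the entropy of the inlet belongs to the flow generated
by the inlet. -/
theorem reaches_and_eq_inRatio {w : RadialFlow} (hw : w.HasInvariants d γ r) (hγ : 1 < γ)
    (hd : d.Admissible γ) (hr : 0 < r) (hA : w.A r = d.A₀) (h1 : 1 < w.velocityRatio d γ r) :
    d.Reaches γ r ∧ w.velocityRatio d γ r = d.inRatio γ r := by
  have hh := hw.enthalpy_pos hγ hr
  have hs := entropyScale_pos hγ hd hr hh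
  have hA' := hw.A_eq hγ hd hr
  rw [hA] at hA'
  have e : d.A₀ / d.entropyScale γ r = entropyProfile γ (w.velocityRatio d γ r) := by
    rw [hA']; field_simp
  refine ⟨⟨hr, hh, ?_⟩, ?_⟩
  · rw [e]
    exact entropyProfile_lt_one hγ (by linarith) h1.ne'
  · rw [inRatio, e, eq_superRatio hγ ⟨h1, (hw.velocityRatio_mem hγ hd hr).2⟩]

theorem reaches_r₀ (hγ : 1 < γ) (hd : d.Admissible γ) : d.Reaches γ d.r₀ := by
  -- Only the values at `r₀` matter here, so constant fields suffice; they are not meant to solve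
  -- the equations.
  have hm : d.Matches ⟨fun _ => d.ρ₀, fun _ => d.U₁₀, fun _ => d.U₂₀, fun _ => d.A₀⟩ :=
    ⟨rfl, rfl, rfl, rfl⟩
  exact (reaches_and_eq_inRatio (hm.hasInvariants hγ hd) hγ hd hd.r₀_pos rfl
    (hm.one_lt_velocityRatio hγ hd)).1

namespace Reaches

theorem scale_pos (h : d.Reaches γ r) (hγ : 1 < γ) (hd : d.Admissible γ) :
    0 < d.entropyScale γ r := entropyScale_pos hγ hd h.pos h.enthalpy_pos

theorem mem (h : d.Reaches γ r) (hγ : 1 < γ) (hd : d.Admissible γ) :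
    d.A₀ / d.entropyScale γ r ∈ Ioo 0 (entropyProfile γ 1) :=
  ⟨div_pos hd.A₀_pos (h.scale_pos hγ hd), h.lt⟩

/-- As `S` increases, `A₀/S` falls further below `Ψ(1)`: the supersonic flow continues outwards to
every radius. Inwards it may choke. -/
theorem mono (h : d.Reaches γ r) (hγ : 1 < γ) (hd : d.Admissible γ) {s : ℝ} (hs : r ≤ s) :
    d.Reaches γ s := by
  rcases hs.eq_or_lt with rfl | hs
  · exact h
  have h0 := h.pos.trans hs
  refine ⟨h0, h.enthalpy_pos.trans (enthalpy_strictMonoOn hd h.pos h0 hs), lt_trans ?_ h.lt⟩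
  exact div_lt_div_of_pos_left hd.A₀_pos (h.scale_pos hγ hd)
    (entropyScale_lt hγ hd h.pos h.enthalpy_pos hs)

theorem inRatio_mem (h : d.Reaches γ r) (hγ : 1 < γ) (hd : d.Admissible γ) :
    d.inRatio γ r ∈ Ioo 1 (limitRatio γ) := superRatio_mem hγ (h.mem hγ hd)

theorem inRatio_pos (h : d.Reaches γ r) (hγ : 1 < γ) (hd : d.Admissible γ) :
    0 < d.inRatio γ r := one_pos.trans (h.inRatio_mem hγ hd).1

theorem inRatio_inv_mem (h : d.Reaches γ r) (hγ : 1 < γ) (hd : d.Admissible γ) :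
    (d.inRatio γ r)⁻¹ ∈ Ioo (0 : ℝ) 1 :=
  ⟨inv_pos.2 (h.inRatio_pos hγ hd), inv_lt_one_of_one_lt₀ (h.inRatio_mem hγ hd).1⟩

theorem entropy_eq (h : d.Reaches γ r) (hγ : 1 < γ) (hd : d.Admissible γ) :
    d.entropyScale γ r * entropyProfile γ (d.inRatio γ r) = d.A₀ := by
  rw [inRatio, entropyProfile_superRatio hγ (h.mem hγ hd)]
  have := h.scale_pos hγ hd
  field_simp

theorem contDiffAt_inRatio (h : d.Reaches γ r) (hγ : 1 < γ) (hd : d.Admissible γ) :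
    ContDiffAt ℝ ∞ (d.inRatio γ) r :=
  (contDiffAt_superRatio hγ (h.mem hγ hd)).comp r
    (contDiffAt_const.div (contDiffAt_entropyScale h.pos h.enthalpy_pos) (h.scale_pos hγ hd).ne')

theorem inRatio_lt (h : d.Reaches γ r) (hγ : 1 < γ) (hd : d.Admissible γ) {s : ℝ} (hs : r < s) :
    d.inRatio γ r < d.inRatio γ s :=
  superRatio_strictAntiOn hγ ((h.mono hγ hd hs.le).mem hγ hd) (h.mem hγ hd)
    (div_lt_div_of_pos_left hd.A₀_pos (h.scale_pos hγ hd)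
      (entropyScale_lt hγ hd h.pos h.enthalpy_pos hs))

theorem inFlow_hasInvariants (h : d.Reaches γ r) (hγ : 1 < γ) (hd : d.Admissible γ) :
    (d.inFlow γ).HasInvariants d γ r :=
  ratioFlow_hasInvariants hγ hd h.pos h.enthalpy_pos
    ⟨h.inRatio_pos hγ hd, (h.inRatio_mem hγ hd).2⟩ (h.entropy_eq hγ hd)

theorem velocityRatio_inFlow (h : d.Reaches γ r) (hγ : 1 < γ) (hd : d.Admissible γ) :
    (d.inFlow γ).velocityRatio d γ r = d.inRatio γ r :=
  velocityRatio_ratioFlow hγ h.enthalpy_pos (h.inRatio_pos hγ hd)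

theorem soundSpeed_lt (h : d.Reaches γ r) (hγ : 1 < γ) (hd : d.Admissible γ) :
    (d.inFlow γ).soundSpeed γ r < (d.inFlow γ).U₁ r := by
  rw [(h.inFlow_hasInvariants hγ hd).soundSpeed_lt_iff hγ hd h.pos, h.velocityRatio_inFlow hγ hd]
  exact (h.inRatio_mem hγ hd).1

theorem inFlow_isEulerOn (h : d.Reaches γ r) (hγ : 1 < γ) (hd : d.Admissible γ) {s : ℝ} :
    (d.inFlow γ).IsEulerOn γ r s :=
  ratioFlow_isEulerOn hγ hd h.pos (fun _ hq => (h.mono hγ hd hq.1).enthalpy_pos)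
    (fun _ hq => ⟨(h.mono hγ hd hq.1).inRatio_pos hγ hd, ((h.mono hγ hd hq.1).inRatio_mem hγ hd).2⟩)
    (fun _ hq => (h.mono hγ hd hq.1).entropy_eq hγ hd)
    (fun _ hq => (h.mono hγ hd hq.1).contDiffAt_inRatio hγ hd)

theorem inFlow_smoothOn (h : d.Reaches γ r) (hγ : 1 < γ) (hd : d.Admissible γ) {s : ℝ} :
    (d.inFlow γ).SmoothOn (Icc r s) := by
  have H := fun q (hq : q ∈ Icc r s) => contDiffAt_ratioFlow (A := d.A₀) hγ h.pos
    (fun _ hq => (h.mono hγ hd hq.1).enthalpy_pos)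
    (fun _ hq => ⟨(h.mono hγ hd hq.1).inRatio_pos hγ hd, ((h.mono hγ hd hq.1).inRatio_mem hγ hd).2⟩)
    (fun _ hq => (h.mono hγ hd hq.1).contDiffAt_inRatio hγ hd) hq
  exact ⟨fun q hq => (H q hq).1.contDiffWithinAt, fun q hq => (H q hq).2.1.contDiffWithinAt,
    fun q hq => (H q hq).2.2.1.contDiffWithinAt, fun q hq => (H q hq).2.2.2.contDiffWithinAt⟩

theorem shockEntropy_pos (h : d.Reaches γ r) (hγ : 1 < γ) (hd : d.Admissible γ) :
    0 < d.shockEntropy γ r :=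
  mul_pos (h.scale_pos hγ hd) (entropyProfile_pos ⟨(h.inRatio_inv_mem hγ hd).1,
    (h.inRatio_inv_mem hγ hd).2.trans (one_lt_limitRatio hγ)⟩)

/-- Eliminating `S` through `A₀ = S Ψ(x⁻)` leaves `A₀ Ψ(1/x⁻)/Ψ(x⁻)`, which depends on the radius
only through the increasing `x⁻`. -/
theorem shockEntropy_lt (h : d.Reaches γ r) (hγ : 1 < γ) (hd : d.Admissible γ) {s : ℝ}
    (hs : r < s) : d.shockEntropy γ r < d.shockEntropy γ s := by
  have key : ∀ q, d.Reaches γ q → d.shockEntropy γ q = d.A₀ *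
      (entropyProfile γ (d.inRatio γ q)⁻¹ / entropyProfile γ (d.inRatio γ q)) := by
    intro q hq
    have h1 : 0 < entropyProfile γ (d.inRatio γ q) :=
      entropyProfile_pos ⟨hq.inRatio_pos hγ hd, (hq.inRatio_mem hγ hd).2⟩
    rw [← hq.entropy_eq hγ hd, shockEntropy]
    field_simp
  have hs' := h.mono hγ hd hs.le
  rw [key r h, key s hs']
  exact mul_lt_mul_of_pos_left (shockEntropyRatio_strictMonoOn hγ (h.inRatio_mem hγ hd)
    (hs'.inRatio_mem hγ hd) (h.inRatio_lt hγ hd hs)) hd.A₀_pos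

theorem continuousAt_shockEntropy (h : d.Reaches γ r) (hγ : 1 < γ) (hd : d.Admissible γ) :
    ContinuousAt (d.shockEntropy γ) r :=
  (contDiffAt_entropyScale h.pos h.enthalpy_pos).continuousAt.mul
    ((continuous_entropyProfile hγ).continuousAt.comp
      ((h.contDiffAt_inRatio hγ hd).continuousAt.inv₀ (h.inRatio_pos hγ hd).ne'))

/-- The range of the parameter of the flow behind a shock at the radius `b`. -/
theorem out_mem (h : d.Reaches γ b) (hγ : 1 < γ) (hd : d.Admissible γ) (hr : b ≤ r) :
    d.shockEntropy γ b / d.entropyScale γ r ∈ Ioo 0 (entropyProfile γ 1) := by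
  have hr' := h.mono hγ hd hr
  refine ⟨div_pos (h.shockEntropy_pos hγ hd) (hr'.scale_pos hγ hd), ?_⟩
  rw [div_lt_iff₀ (hr'.scale_pos hγ hd), shockEntropy, mul_comm]
  have h1 : entropyProfile γ (d.inRatio γ b)⁻¹ < entropyProfile γ 1 :=
    entropyProfile_lt_one hγ (h.inRatio_inv_mem hγ hd).1 (h.inRatio_inv_mem hγ hd).2.ne
  have h2 : d.entropyScale γ b ≤ d.entropyScale γ r := by
    rcases hr.eq_or_lt with rfl | hr
    · exact le_rfl
    · exact (entropyScale_lt hγ hd h.pos h.enthalpy_pos hr).le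
  have h3 : 0 < entropyProfile γ 1 := entropyProfile_pos ⟨one_pos, one_lt_limitRatio hγ⟩
  exact (mul_lt_mul_of_pos_right h1 (h.scale_pos hγ hd)).trans_le
    (mul_le_mul_of_nonneg_left h2 h3.le)

theorem outRatio_mem (h : d.Reaches γ b) (hγ : 1 < γ) (hd : d.Admissible γ) (hr : b ≤ r) :
    d.outRatio γ b r ∈ Ioo (0 : ℝ) 1 := subRatio_mem hγ (h.out_mem hγ hd hr)

theorem outRatio_mem' (h : d.Reaches γ b) (hγ : 1 < γ) (hd : d.Admissible γ) (hr : b ≤ r) :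
    d.outRatio γ b r ∈ Ioo 0 (limitRatio γ) :=
  ⟨(h.outRatio_mem hγ hd hr).1, (h.outRatio_mem hγ hd hr).2.trans (one_lt_limitRatio hγ)⟩

theorem outRatio_self (h : d.Reaches γ b) (hγ : 1 < γ) (hd : d.Admissible γ) :
    d.outRatio γ b b = (d.inRatio γ b)⁻¹ := by
  have := h.scale_pos hγ hd
  rw [outRatio, shockEntropy, mul_div_cancel_left₀ _ this.ne',
    eq_subRatio hγ (h.inRatio_inv_mem hγ hd)]

theorem out_entropy_eq (h : d.Reaches γ b) (hγ : 1 < γ) (hd : d.Admissible γ) (hr : b ≤ r) :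
    d.entropyScale γ r * entropyProfile γ (d.outRatio γ b r) = d.shockEntropy γ b := by
  rw [outRatio, entropyProfile_subRatio hγ (h.out_mem hγ hd hr)]
  have := (h.mono hγ hd hr).scale_pos hγ hd
  field_simp

theorem contDiffAt_outRatio (h : d.Reaches γ b) (hγ : 1 < γ) (hd : d.Admissible γ)
    (hr : b ≤ r) : ContDiffAt ℝ ∞ (d.outRatio γ b) r :=
  (contDiffAt_subRatio hγ (h.out_mem hγ hd hr)).comp r
    (contDiffAt_const.div (contDiffAt_entropyScale (h.pos.trans_le hr)
      (h.mono hγ hd hr).enthalpy_pos) ((h.mono hγ hd hr).scale_pos hγ hd).ne')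

theorem outRatio_lt (h : d.Reaches γ b) (hγ : 1 < γ) (hd : d.Admissible γ) {s : ℝ}
    (hr : b ≤ r) (hs : r < s) : d.outRatio γ b s < d.outRatio γ b r :=
  subRatio_strictMonoOn hγ (h.out_mem hγ hd (hr.trans hs.le)) (h.out_mem hγ hd hr)
    (div_lt_div_of_pos_left (h.shockEntropy_pos hγ hd) ((h.mono hγ hd hr).scale_pos hγ hd)
      (entropyScale_lt hγ hd (h.pos.trans_le hr) (h.mono hγ hd hr).enthalpy_pos hs))

theorem outFlow_hasInvariants (h : d.Reaches γ b) (hγ : 1 < γ) (hd : d.Admissible γ)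
    (hr : b ≤ r) : (d.outFlow γ b).HasInvariants d γ r :=
  ratioFlow_hasInvariants hγ hd (h.pos.trans_le hr) (h.mono hγ hd hr).enthalpy_pos
    (h.outRatio_mem' hγ hd hr) (h.out_entropy_eq hγ hd hr)

theorem velocityRatio_outFlow (h : d.Reaches γ b) (hγ : 1 < γ) (hd : d.Admissible γ)
    (hr : b ≤ r) : (d.outFlow γ b).velocityRatio d γ r = d.outRatio γ b r :=
  velocityRatio_ratioFlow hγ (h.mono hγ hd hr).enthalpy_pos (h.outRatio_mem hγ hd hr).1

theorem lt_soundSpeed (h : d.Reaches γ b) (hγ : 1 < γ) (hd : d.Admissible γ) (hr : b ≤ r) :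
    (d.outFlow γ b).U₁ r < (d.outFlow γ b).soundSpeed γ r := by
  rw [(h.outFlow_hasInvariants hγ hd hr).lt_soundSpeed_iff hγ hd (h.pos.trans_le hr),
    h.velocityRatio_outFlow hγ hd hr]
  exact (h.outRatio_mem hγ hd hr).2

theorem outFlow_isEulerOn (h : d.Reaches γ b) (hγ : 1 < γ) (hd : d.Admissible γ) {s : ℝ} :
    (d.outFlow γ b).IsEulerOn γ b s :=
  ratioFlow_isEulerOn hγ hd h.pos (fun _ hq => (h.mono hγ hd hq.1).enthalpy_pos)
    (fun _ hq => h.outRatio_mem' hγ hd hq.1) (fun _ hq => h.out_entropy_eq hγ hd hq.1)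
    (fun _ hq => h.contDiffAt_outRatio hγ hd hq.1)

theorem outFlow_smoothOn (h : d.Reaches γ b) (hγ : 1 < γ) (hd : d.Admissible γ) {s : ℝ} :
    (d.outFlow γ b).SmoothOn (Icc b s) := by
  have H := fun q (hq : q ∈ Icc b s) => contDiffAt_ratioFlow (A := d.shockEntropy γ b) hγ h.pos
    (fun _ hq => (h.mono hγ hd hq.1).enthalpy_pos) (fun _ hq => h.outRatio_mem' hγ hd hq.1)
    (fun _ hq => h.contDiffAt_outRatio hγ hd hq.1) hq
  exact ⟨fun q hq => (H q hq).1.contDiffWithinAt, fun q hq => (H q hq).2.1.contDiffWithinAt,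
    fun q hq => (H q hq).2.2.1.contDiffWithinAt, fun q hq => (H q hq).2.2.2.contDiffWithinAt⟩

end Reaches

end Inlet

/-! ### Sonic gaps and the threshold radius -/

namespace Inlet

variable {d : Inlet} {γ r b r₁ : ℝ}

theorem enthalpy_mul_sq (hr : 0 < r) : d.enthalpy γ r * r ^ 2 = d.B₀ γ * r ^ 2 - d.κ₂ ^ 2 / 2 := by
  rw [enthalpy]; field_simp

theorem enthalpy_mul_sq_lt (hd : d.Admissible γ) (hγ : 1 < γ) {s : ℝ} (hr : 0 < r) (hs : r < s) :
    d.enthalpy γ r * r ^ 2 < d.enthalpy γ s * s ^ 2 := by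
  have := hd.B₀_pos hγ
  rw [enthalpy_mul_sq hr, enthalpy_mul_sq (hr.trans hs)]
  gcongr

namespace Reaches

/-- Both factors are positive and increasing, the first because the incoming flow accelerates. This
makes the threshold unique. -/
theorem shockGap_lt (h : d.Reaches γ r) (hγ : 1 < γ) (hd : d.Admissible γ) {s : ℝ} (hs : r < s) :
    d.shockGap γ r < d.shockGap γ s := by
  have h1 : (d.inRatio γ s)⁻¹ < (d.inRatio γ r)⁻¹ :=
    inv_strictAnti₀ (h.inRatio_pos hγ hd) (h.inRatio_lt hγ hd hs)
  have h2 := enthalpy_mul_sq_lt hd hγ h.pos hs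
  have h3 : 0 < d.enthalpy γ r * r ^ 2 := mul_pos h.enthalpy_pos (pow_pos h.pos 2)
  have h4 := (h.inRatio_inv_mem hγ hd).2
  exact mul_lt_mul'' (by linarith) h2 (by linarith) h3.le

theorem continuousAt_shockGap (h : d.Reaches γ r) (hγ : 1 < γ) (hd : d.Admissible γ) :
    ContinuousAt (d.shockGap γ) r :=
  (continuousAt_const.sub ((h.contDiffAt_inRatio hγ hd).continuousAt.inv₀
    (h.inRatio_pos hγ hd).ne')).mul
    ((contDiffAt_enthalpy h.pos).continuousAt.mul (continuousAt_id.pow 2))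

theorem sonicGap_self (h : d.Reaches γ b) (hγ : 1 < γ) (hd : d.Admissible γ) :
    d.sonicGap γ b b = d.shockGap γ b := by
  rw [sonicGap, shockGap, h.outRatio_self hγ hd]

/-- The flow behind the shock decelerates, so both factors are positive and increasing; hence `|M|²
= 1` occurs at most once. -/
theorem sonicGap_lt (h : d.Reaches γ b) (hγ : 1 < γ) (hd : d.Admissible γ) {s : ℝ}
    (hr : b ≤ r) (hs : r < s) : d.sonicGap γ b r < d.sonicGap γ b s := by
  have h1 := h.outRatio_lt hγ hd hr hs
  have hr' := h.mono hγ hd hr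
  have h2 := enthalpy_mul_sq_lt hd hγ hr'.pos hs
  have h3 : 0 < d.enthalpy γ r * r ^ 2 := mul_pos hr'.enthalpy_pos (pow_pos hr'.pos 2)
  have h4 := (h.outRatio_mem hγ hd hr).2
  exact mul_lt_mul'' (by linarith) h2 (by linarith) h3.le

theorem continuousAt_sonicGap (h : d.Reaches γ b) (hγ : 1 < γ) (hd : d.Admissible γ)
    (hr : b ≤ r) : ContinuousAt (d.sonicGap γ b) r :=
  (continuousAt_const.sub (h.contDiffAt_outRatio hγ hd hr).continuousAt).mul
    ((contDiffAt_enthalpy (h.pos.trans_le hr)).continuousAt.mul (continuousAt_id.pow 2))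

theorem one_lt_machSq_iff (h : d.Reaches γ b) (hγ : 1 < γ) (hd : d.Admissible γ) (hr : b ≤ r) :
    1 < (d.outFlow γ b).machSq γ r ↔ d.sonicGap γ b r < d.κ₂ ^ 2 / (γ - 1) := by
  rw [(h.outFlow_hasInvariants hγ hd hr).one_lt_machSq_iff hγ (h.pos.trans_le hr),
    h.velocityRatio_outFlow hγ hd hr, sonicGap]

theorem machSq_eq_one_iff (h : d.Reaches γ b) (hγ : 1 < γ) (hd : d.Admissible γ) (hr : b ≤ r) :
    (d.outFlow γ b).machSq γ r = 1 ↔ d.sonicGap γ b r = d.κ₂ ^ 2 / (γ - 1) := by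
  rw [(h.outFlow_hasInvariants hγ hd hr).machSq_eq_one_iff hγ (h.pos.trans_le hr),
    h.velocityRatio_outFlow hγ hd hr, sonicGap]

theorem machSq_lt_one_iff (h : d.Reaches γ b) (hγ : 1 < γ) (hd : d.Admissible γ) (hr : b ≤ r) :
    (d.outFlow γ b).machSq γ r < 1 ↔ d.κ₂ ^ 2 / (γ - 1) < d.sonicGap γ b r := by
  rw [(h.outFlow_hasInvariants hγ hd hr).machSq_lt_one_iff hγ (h.pos.trans_le hr),
    h.velocityRatio_outFlow hγ hd hr, sonicGap]

theorem one_lt_machSq_inFlow (h : d.Reaches γ r) (hγ : 1 < γ) (hd : d.Admissible γ) :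
    1 < (d.inFlow γ).machSq γ r := by
  have hr := h.pos
  rw [(h.inFlow_hasInvariants hγ hd).one_lt_machSq_iff hγ hr, h.velocityRatio_inFlow hγ hd]
  have h1 := (h.inRatio_mem hγ hd).1
  have h2 : 0 < d.enthalpy γ r * r ^ 2 := mul_pos h.enthalpy_pos (pow_pos hr 2)
  have h3 : 0 < d.κ₂ ^ 2 / (γ - 1) := div_pos hd.κ₂_sq_pos (by linarith)
  nlinarith

end Reaches

theorem inFlow_matches (hγ : 1 < γ) (hd : d.Admissible γ) : d.Matches (d.inFlow γ) := by
  have hm : d.Matches ⟨fun _ => d.ρ₀, fun _ => d.U₁₀, fun _ => d.U₂₀, fun _ => d.A₀⟩ :=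
    ⟨rfl, rfl, rfl, rfl⟩
  have hR := reaches_r₀ hγ hd
  have h1 := hm.hasInvariants hγ hd
  have h2 := (reaches_and_eq_inRatio h1 hγ hd hd.r₀_pos rfl (hm.one_lt_velocityRatio hγ hd)).2
  exact (hR.inFlow_hasInvariants hγ hd).eq_of_velocityRatio_eq h1 hγ hd hd.r₀_pos
    ((hR.velocityRatio_inFlow hγ hd).trans h2.symm)

/-- The gap behind the shock attains the sonic value at some radius. -/
theorem exists_shockGap_eq (hγ : 1 < γ) (hd : d.Admissible γ) :
    ∃ r, d.Reaches γ r ∧ d.shockGap γ r = d.κ₂ ^ 2 / (γ - 1) := by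
  set c := d.κ₂ ^ 2 / (γ - 1) with hc
  have hc0 : 0 < c := div_pos hd.κ₂_sq_pos (by linarith)
  have h0 := reaches_r₀ hγ hd
  have hB := hd.B₀_pos hγ
  have hivt : ∀ a e, d.Reaches γ a → a ≤ e → d.shockGap γ a ≤ c → c ≤ d.shockGap γ e →
      ∃ r, d.Reaches γ r ∧ d.shockGap γ r = c := by
    intro a e ha hae h1 h2
    obtain ⟨q, hq, hqc⟩ := intermediate_value_Icc hae (f := d.shockGap γ) (fun q hq =>
      ((ha.mono hγ hd hq.1).continuousAt_shockGap hγ hd).continuousWithinAt) ⟨h1, h2⟩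
    exact ⟨q, ha.mono hγ hd hq.1, hqc⟩
  rcases le_total (d.shockGap γ d.r₀) c with hle | hle
  -- Outward search: the first factor stays above its value `m` at `r₀`, while `h r²` is unbounded.
  · set m := 1 - (d.inRatio γ d.r₀)⁻¹ with hm
    have hm0 : 0 < m := sub_pos.2 (h0.inRatio_inv_mem hγ hd).2
    obtain ⟨e, he1, he2⟩ : ∃ e, d.r₀ < e ∧ c / m ≤ d.enthalpy γ e * e ^ 2 := by
      have ht : Tendsto (fun e : ℝ => d.B₀ γ * e ^ 2 - d.κ₂ ^ 2 / 2) atTop atTop :=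
        tendsto_atTop_add_const_right _ _ ((tendsto_pow_atTop two_ne_zero).const_mul_atTop hB)
      obtain ⟨e, he1, he2⟩ := ((eventually_gt_atTop d.r₀).and
        (ht.eventually_ge_atTop (c / m))).exists
      refine ⟨e, he1, ?_⟩
      rw [enthalpy_mul_sq (hd.r₀_pos.trans he1)]
      exact he2
    refine hivt _ e h0 he1.le hle ?_
    have h1 : (d.inRatio γ e)⁻¹ < (d.inRatio γ d.r₀)⁻¹ :=
      inv_strictAnti₀ (h0.inRatio_pos hγ hd) (h0.inRatio_lt hγ hd he1)
    rw [div_le_iff₀' hm0] at he2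
    refine he2.trans (mul_le_mul_of_nonneg_right (by linarith) ?_)
    have := (h0.mono hγ hd he1.le).enthalpy_pos
    positivity
  -- Inward search: the gap becomes small as the flow approaches the critical ratio 1, and the
  -- second factor stays below its value `g` at `r₀`.
  · set g := d.enthalpy γ d.r₀ * d.r₀ ^ 2 with hg
    set x₀ := d.inRatio γ d.r₀ with hx₀
    have hx₀1 := (h0.inRatio_mem hγ hd).1
    -- a velocity ratio so close to one that the gap is small
    obtain ⟨y, hy1, hy2, hy3⟩ : ∃ y, 1 < y ∧ y < x₀ ∧ (1 - y⁻¹) * g ≤ c := by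
      have ht : ContinuousAt (fun y : ℝ => (1 - y⁻¹) * g) 1 := by
        have := continuousAt_inv₀ (one_ne_zero (α := ℝ))
        fun_prop
      have h1 : ∀ᶠ y in 𝓝[>] (1 : ℝ), (1 - y⁻¹) * g < c :=
        (ht.eventually (gt_mem_nhds (by simpa using hc0))).filter_mono nhdsWithin_le_nhds
      obtain ⟨y, hy, hy'⟩ := (h1.and (Ioo_mem_nhdsGT hx₀1)).exists
      exact ⟨y, hy'.1, hy'.2, hy.le⟩
    have hyk := hy2.trans (h0.inRatio_mem hγ hd).2
    have hΨ : 0 < entropyProfile γ y := entropyProfile_pos ⟨by linarith, hyk⟩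
    have hΨ1 : entropyProfile γ x₀ < entropyProfile γ y :=
      entropyProfile_strictAntiOn hγ hy1.le hx₀1.le hy2
    have hs : d.A₀ / entropyProfile γ y < d.entropyScale γ d.r₀ := by
      rw [← h0.entropy_eq hγ hd, div_lt_iff₀ hΨ]
      exact mul_lt_mul_of_pos_left hΨ1 (h0.scale_pos hγ hd)
    -- `S` vanishes with the enthalpy at `l`, so it takes the value `A₀/Ψ(y)` between `l` and `r₀`;
    -- the incoming ratio is `y` there.
    obtain ⟨l, hl0, hl1, hl2⟩ : ∃ l, 0 < l ∧ l < d.r₀ ∧ d.enthalpy γ l = 0 := by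
      have hκ := hd.κ₂_sq_pos
      have hκ0 : d.κ₂ ≠ 0 := fun h => by simp [h] at hκ
      have hl0 : 0 < √(d.κ₂ ^ 2 / (2 * d.B₀ γ)) := Real.sqrt_pos.2 (by positivity)
      have hl : d.enthalpy γ √(d.κ₂ ^ 2 / (2 * d.B₀ γ)) = 0 := by
        rw [enthalpy, Real.sq_sqrt (by positivity)]
        field_simp
        ring
      refine ⟨_, hl0, ?_, hl⟩
      rw [← (enthalpy_strictMonoOn hd).lt_iff_lt hl0 hd.r₀_pos, hl]
      exact h0.enthalpy_pos
    have hsl : d.entropyScale γ l = 0 := by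
      rw [entropyScale, hl2, Real.zero_rpow (by linarith), zero_mul, mul_zero]
    obtain ⟨q, hq, hqs⟩ := intermediate_value_Ioo hl1.le
      ((continuousOn_entropyScale hγ (d := d)).mono fun t ht => hl0.trans_le ht.1)
      (show d.A₀ / entropyProfile γ y ∈ _ from ⟨by rw [hsl]; exact div_pos hd.A₀_pos hΨ, hs⟩)
    have hq0 : 0 < q := hl0.trans hq.1
    have hqe : d.A₀ / d.entropyScale γ q = entropyProfile γ y := by
      have := hd.A₀_pos
      rw [hqs]; field_simp
    have hR : d.Reaches γ q := by
      refine ⟨hq0, ?_, ?_⟩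
      · rw [← hl2]
        exact enthalpy_strictMonoOn hd hl0 hq0 hq.1
      · rw [hqe]
        exact entropyProfile_lt_one hγ (by linarith) hy1.ne'
    refine hivt q d.r₀ hR hq.2.le ?_ hle
    have hqy : d.inRatio γ q = y := by rw [inRatio, hqe, eq_superRatio hγ ⟨hy1, hyk⟩]
    rw [shockGap, hqy]
    have hy0 : 0 ≤ 1 - y⁻¹ := sub_nonneg.2 (inv_le_one_of_one_le₀ hy1.le)
    exact (mul_le_mul_of_nonneg_left (enthalpy_mul_sq_lt hd hγ hq0 hq.2).le hy0).trans hy3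

/-- The threshold radii are those where the state behind the shock is sonic. -/
theorem isThreshold_iff (hγ : 1 < γ) (hd : d.Admissible γ) :
    d.IsThreshold γ r ↔ d.Reaches γ r ∧ d.shockGap γ r = d.κ₂ ^ 2 / (γ - 1) := by
  have h0 := reaches_r₀ hγ hd
  constructor
  · rintro ⟨hlt, w, hw, hm, hsup, hf⟩
    have hr : 0 < r := (Real.sqrt_nonneg _).trans_lt hlt
    have hmin : 0 < min d.r₀ r := lt_min hd.r₀_pos hr
    have hrI : r ∈ Icc (min d.r₀ r) (max d.r₀ r) := ⟨min_le_right _ _, le_max_right _ _⟩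
    obtain ⟨h1, h2⟩ := hw.hasInvariants hγ hd hmin ⟨min_le_left _ _, le_max_left _ _⟩
      (hm.hasInvariants hγ hd) hrI
    have h3 := hsup r hrI
    rw [h1.soundSpeed_lt_iff hγ hd hr] at h3
    obtain ⟨h4, h5⟩ := reaches_and_eq_inRatio h1 hγ hd hr (h2.trans hm.2.2.2) h3
    rw [h1.f₁_eq_one_iff hγ hd hr, h5] at hf
    exact ⟨h4, hf⟩
  · rintro ⟨hR, hg⟩
    have hmin : d.Reaches γ (min d.r₀ r) := by
      rcases min_choice d.r₀ r with h | h <;> rw [h] <;> assumption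
    refine ⟨?_, d.inFlow γ, hmin.inFlow_isEulerOn hγ hd, inFlow_matches hγ hd,
      fun s hs => (hmin.mono hγ hd hs.1).soundSpeed_lt hγ hd, ?_⟩
    -- The bound `r > r_*` is automatic: it is what the gap equation gives when `x⁻` is replaced by
    -- its upper bound `k`.
    · rw [rStar, Real.sqrt_lt' hR.pos]
      have hB := hd.B₀_pos hγ
      have hk := one_lt_limitRatio hγ
      have hγ1 : 0 < γ - 1 := by linarith
      have h1 : (limitRatio γ)⁻¹ < (d.inRatio γ r)⁻¹ :=
        inv_strictAnti₀ (hR.inRatio_pos hγ hd) (hR.inRatio_mem hγ hd).2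
      have h2 : 0 < d.enthalpy γ r * r ^ 2 := mul_pos hR.enthalpy_pos (pow_pos hR.pos 2)
      have h3 : d.κ₂ ^ 2 / (γ - 1) < (1 - (limitRatio γ)⁻¹) * (d.enthalpy γ r * r ^ 2) := by
        rw [← hg, shockGap]
        exact mul_lt_mul_of_pos_right (by linarith) h2
      rw [enthalpy_mul_sq hR.pos, limitRatio, inv_div] at h3
      have hγ2 : 0 < γ + 1 := by linarith
      have e : 1 - (γ - 1) / (γ + 1) = 2 / (γ + 1) := by field_simp; ring
      rw [e, div_mul_eq_mul_div, div_lt_div_iff₀ hγ1 hγ2] at h3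
      rw [div_lt_iff₀ (mul_pos hγ1 hB)]
      linarith
    · rw [(hR.inFlow_hasInvariants hγ hd).f₁_eq_one_iff hγ hd hR.pos,
        hR.velocityRatio_inFlow hγ hd]
      exact hg

/-! ### Exit pressure and classification of shock solutions -/

noncomputable section

/-- Exit pressure at the radius `r₁` of the flow with a shock at the radius `b`. -/
def exitPressure (d : Inlet) (γ r₁ b : ℝ) : ℝ := d.ratioPressure γ r₁ (d.outRatio γ b r₁)

end

/-- A shock further out is stronger and leaves more entropy; on the subsonic branch this gives a
larger exit ratio and so a smaller exit pressure. -/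
theorem exitPressure_strictAntiOn (hγ : 1 < γ) (hd : d.Admissible γ) :
    StrictAntiOn (d.exitPressure γ r₁) (Icc d.r₀ r₁) := by
  intro a ha b hb hab
  have hRa := (reaches_r₀ hγ hd).mono hγ hd ha.1
  have hRb := (reaches_r₀ hγ hd).mono hγ hd hb.1
  have hR1 := hRa.mono hγ hd ha.2
  refine ratioPressure_strictAntiOn hγ hd hR1.pos hR1.enthalpy_pos
    (hRa.outRatio_mem' hγ hd ha.2) (hRb.outRatio_mem' hγ hd hb.2) ?_
  exact subRatio_strictMonoOn hγ (hRa.out_mem hγ hd ha.2) (hRb.out_mem hγ hd hb.2)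
    (div_lt_div_of_pos_right (hRa.shockEntropy_lt hγ hd hab) (hR1.scale_pos hγ hd))

theorem continuousOn_exitPressure (hγ : 1 < γ) (hd : d.Admissible γ) :
    ContinuousOn (d.exitPressure γ r₁) (Icc d.r₀ r₁) := by
  intro b hb
  have hR := (reaches_r₀ hγ hd).mono hγ hd hb.1
  have hR1 := hR.mono hγ hd hb.2
  have h1 : ContinuousAt (fun b => d.outRatio γ b r₁) b :=
    ContinuousAt.comp (g := subRatio γ) (contDiffAt_subRatio hγ
      (hR.out_mem hγ hd hb.2)).continuousAt
      ((hR.continuousAt_shockEntropy hγ hd).div_const _)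
  have h2 : ContinuousAt (d.ratioPressure γ r₁) (d.outRatio γ b r₁) :=
    (continuousOn_ratioPressure hγ hR1.pos hR1.enthalpy_pos).continuousAt
      (Ioi_mem_nhds (hR.outRatio_mem hγ hd hb.2).1)
  exact (ContinuousAt.comp (f := fun b => d.outRatio γ b r₁) h2 h1).continuousWithinAt

/-- Existence of the transonic shock at a given radius. -/
theorem isShockSolution (hγ : 1 < γ) (hd : d.Admissible γ) (hb : b ∈ Ioo d.r₀ r₁) :
    IsShockSolution d γ r₁ (d.exitPressure γ r₁ b) b (d.inFlow γ) (d.outFlow γ b) := by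
  have h0 := reaches_r₀ hγ hd
  have hR := h0.mono hγ hd hb.1.le
  have hR1 := hR.mono hγ hd hb.2.le
  have hm := hR.inFlow_hasInvariants hγ hd
  have hp := hR.outFlow_hasInvariants hγ hd le_rfl
  have hp1 := hR.outFlow_hasInvariants hγ hd hb.2.le
  have hj := hm.jump_of_velocityRatio_eq_inv hp hγ hd hR.pos
    (by rw [hR.velocityRatio_outFlow hγ hd le_rfl, hR.outRatio_self hγ hd,
      hR.velocityRatio_inFlow hγ hd])
    (by rw [hR.velocityRatio_inFlow hγ hd]; exact (hR.inRatio_mem hγ hd).1)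
  have hmass : (d.outFlow γ b).ρ b * (d.outFlow γ b).U₁ b =
      (d.inFlow γ).ρ b * (d.inFlow γ).U₁ b :=
    mul_left_cancel₀ hR.pos.ne' (hp.mass.trans hm.mass.symm)
  refine ⟨hb, h0.inFlow_isEulerOn hγ hd, hR.outFlow_isEulerOn hγ hd, inFlow_matches hγ hd, ?_,
    hmass, hj.1, ?_, hp.bernoulli.trans hm.bernoulli.symm, hj.2⟩
  · rw [hp1.pressure_eq hγ hd hR1.pos, hR.velocityRatio_outFlow hγ hd hb.2.le, exitPressure]
  · rw [hmass, hp.U₂_eq hR.pos, hm.U₂_eq hR.pos]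

/-- Every shock solution is the one with the same shock circle. -/
theorem agreeOn_of_isShockSolution (hγ : 1 < γ) (hd : d.Admissible γ) {pex : ℝ}
    {wm wp : RadialFlow} (hs : IsShockSolution d γ r₁ pex b wm wp) :
    pex = d.exitPressure γ r₁ b ∧ wm.AgreeOn (d.inFlow γ) (Icc d.r₀ b) ∧
      wp.AgreeOn (d.outFlow γ b) (Icc b r₁) := by
  have h0 := reaches_r₀ hγ hd
  have hb := hs.location
  have hR := h0.mono hγ hd hb.1.le
  have hR1 := hR.mono hγ hd hb.2.le
  have hi0 := hs.entrance.hasInvariants hγ hd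
  have hminus : ∀ r ∈ Icc d.r₀ b, wm.HasInvariants d γ r ∧
      wm.velocityRatio d γ r = d.inRatio γ r := by
    intro r hr
    obtain ⟨h1, h2⟩ := hs.euler_minus.hasInvariants hγ hd hd.r₀_pos
      (left_mem_Icc.2 hb.1.le) hi0 hr
    exact ⟨h1, (reaches_and_eq_inRatio h1 hγ hd (hd.r₀_pos.trans_le hr.1)
      (h2.trans hs.entrance.2.2.2) (hs.euler_minus.one_lt_velocityRatio hγ hd hd.r₀_pos hi0
        (hs.entrance.one_lt_velocityRatio hγ hd) hr)).2⟩
  obtain ⟨hmb, hxb⟩ := hminus b (right_mem_Icc.2 hb.1.le)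
  have hbI : b ∈ Icc b r₁ := left_mem_Icc.2 hb.2.le
  have hρU : wm.ρ b * wm.U₁ b ≠ 0 := (mul_pos hmb.ρ_pos (hmb.U₁_pos hd hR.pos)).ne'
  -- The jump conditions carry mass flux, angular momentum and Bernoulli constant across the shock;
  -- only the entropy changes.
  have hpb : wp.HasInvariants d γ b := by
    refine ⟨hs.euler_plus.ρ_pos b hbI, hs.euler_plus.A_pos b hbI, ?_, ?_, ?_⟩
    · rw [hs.rh_mass, hmb.mass]
    · have := hs.rh_angular
      rw [hs.rh_mass] at this
      rw [mul_left_cancel₀ hρU this, hmb.angular]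
    · rw [hs.rh_bernoulli, hmb.bernoulli]
  have hxp := hmb.velocityRatio_eq_inv hpb hγ hd hR.pos hs.rh_radial hs.entropy_condition
  rw [hxb] at hxp
  have hAb : wp.A b = d.shockEntropy γ b := by
    rw [hpb.A_eq hγ hd hR.pos, hxp, shockEntropy]
  have hplus : ∀ r ∈ Icc b r₁, wp.HasInvariants d γ r ∧
      wp.velocityRatio d γ r = d.outRatio γ b r := by
    intro r hr
    have hr0 := hR.pos.trans_le hr.1
    obtain ⟨h1, h2⟩ := hs.euler_plus.hasInvariants hγ hd hR.pos hbI hpb hr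
    refine ⟨h1, ?_⟩
    have h3 := hs.euler_plus.velocityRatio_lt_one hγ hd hR.pos hpb
      (by rw [hxp]; exact (hR.inRatio_inv_mem hγ hd).2) hr
    have h4 := (hR.mono hγ hd hr.1).scale_pos hγ hd
    rw [outRatio, ← hAb, ← h2, h1.A_eq hγ hd hr0, mul_div_cancel_left₀ _ h4.ne',
      eq_subRatio hγ ⟨(h1.velocityRatio_mem hγ hd hr0).1, h3⟩]
  have hm' := fun r (hr : r ∈ Icc d.r₀ b) =>
    (hminus r hr).1.eq_of_velocityRatio_eq ((h0.mono hγ hd hr.1).inFlow_hasInvariants hγ hd) hγ hd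
      (hd.r₀_pos.trans_le hr.1)
      ((hminus r hr).2.trans ((h0.mono hγ hd hr.1).velocityRatio_inFlow hγ hd).symm)
  have hp' := fun r (hr : r ∈ Icc b r₁) =>
    (hplus r hr).1.eq_of_velocityRatio_eq (hR.outFlow_hasInvariants hγ hd hr.1) hγ hd
      (hR.pos.trans_le hr.1)
      ((hplus r hr).2.trans (hR.velocityRatio_outFlow hγ hd hr.1).symm)
  have h1I : r₁ ∈ Icc b r₁ := right_mem_Icc.2 hb.2.le
  refine ⟨?_, ⟨fun r hr => (hm' r hr).1, fun r hr => (hm' r hr).2.1,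
    fun r hr => (hm' r hr).2.2.1, fun r hr => (hm' r hr).2.2.2⟩,
    ⟨fun r hr => (hp' r hr).1, fun r hr => (hp' r hr).2.1,
    fun r hr => (hp' r hr).2.2.1, fun r hr => (hp' r hr).2.2.2⟩⟩
  rw [← hs.exit_pressure, (hplus r₁ h1I).1.pressure_eq hγ hd hR1.pos, (hplus r₁ h1I).2,
    exitPressure]

/-- The gap starts below the sonic value at the shock and increases outwards, so its exit value,
read off from the sign of `f₂(ρ^♯)`, decides the pattern. -/
theorem supersonicShockPatterns (hγ : 1 < γ) (hd : d.Admissible γ) (hb : b ∈ Ioo d.r₀ r₁)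
    (hgap : d.shockGap γ b < d.κ₂ ^ 2 / (γ - 1)) :
    SupersonicShockPatterns d γ r₁ (d.exitPressure γ r₁ b) b (d.inFlow γ) (d.outFlow γ b) := by
  have hR := (reaches_r₀ hγ hd).mono hγ hd hb.1.le
  have hR1 := hR.mono hγ hd hb.2.le
  have hmono : ∀ q s, b ≤ q → q < s → d.sonicGap γ b q < d.sonicGap γ b s :=
    fun q s hq hqs => hR.sonicGap_lt hγ hd hq hqs
  rw [← hR.sonicGap_self hγ hd] at hgap
  have hss : IsSupersonicSupersonicShock γ b (d.inFlow γ) (d.outFlow γ b) :=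
    ⟨hR.one_lt_machSq_inFlow hγ hd, (hR.one_lt_machSq_iff hγ hd le_rfl).2 hgap⟩
  obtain ⟨c, hc, hf⟩ := (hR.outFlow_hasInvariants hγ hd hb.2.le).f₂_ρSharp_eq hγ hd hR1.pos
  rw [(isShockSolution hγ hd hb).exit_pressure] at hf
  unfold SupersonicShockPatterns
  rw [hf]
  refine ⟨fun h => ⟨hss, fun r hr => ?_⟩, fun h => ⟨hss, ?_⟩, fun h => ⟨hss, fun r hr => ?_, ?_⟩⟩
  · have h1 : 1 < (d.outFlow γ b).machSq γ r₁ := by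
      linarith [(mul_pos_iff_of_pos_left hc).1 h]
    rw [hR.one_lt_machSq_iff hγ hd hb.2.le] at h1
    rw [hR.one_lt_machSq_iff hγ hd hr.1]
    rcases hr.2.eq_or_lt with e | e
    · rwa [e]
    · exact (hmono r r₁ hr.1 e).trans h1
  · have h1 : (d.outFlow γ b).machSq γ r₁ < 1 := by
      by_contra! hcon
      exact h.not_ge (mul_nonneg hc.le (by linarith))
    rw [hR.machSq_lt_one_iff hγ hd hb.2.le] at h1
    obtain ⟨q, hq, hqc⟩ := intermediate_value_Ioo hb.2.le (f := d.sonicGap γ b) (fun q hq =>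
      (hR.continuousAt_sonicGap hγ hd hq.1).continuousWithinAt) ⟨hgap, h1⟩
    refine ⟨q, hq, fun r hr => ?_, (hR.machSq_eq_one_iff hγ hd hq.1.le).2 hqc, fun r hr => ?_⟩
    · rw [hR.one_lt_machSq_iff hγ hd hr.1, ← hqc]
      exact hmono r q hr.1 hr.2
    · rw [hR.machSq_lt_one_iff hγ hd (hq.1.trans hr.1).le, ← hqc]
      exact hmono q r hq.1.le hr.1
  · have h1 : (d.outFlow γ b).machSq γ r₁ = 1 := by
      linarith [(mul_eq_zero.1 h).resolve_left hc.ne']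
    rw [hR.machSq_eq_one_iff hγ hd hb.2.le] at h1
    rw [hR.one_lt_machSq_iff hγ hd hr.1, ← h1]
    exact hmono r r₁ hr.1 hr.2
  · linarith [(mul_eq_zero.1 h).resolve_left hc.ne']

theorem Reaches.machSq_lt_one (h : d.Reaches γ b) (hγ : 1 < γ) (hd : d.Admissible γ)
    (hgap : d.κ₂ ^ 2 / (γ - 1) < d.shockGap γ b) (hr : b ≤ r) :
    (d.outFlow γ b).machSq γ r < 1 := by
  rw [← h.sonicGap_self hγ hd] at hgap
  rw [h.machSq_lt_one_iff hγ hd hr]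
  rcases hr.eq_or_lt with rfl | e
  · exact hgap
  · exact hgap.trans (h.sonicGap_lt hγ hd le_rfl e)

end Inlet

/-! ### Inversion of the exit pressure and the main theorem -/

theorem theorem3p1 (γ r₁ : ℝ) (d : Inlet) (hγ : 1 < γ) (hd : d.Admissible γ) (hr : d.r₀ < r₁) :
    ∃ rs : ℝ, d.IsThreshold γ rs ∧ (∀ r, d.IsThreshold γ r → r = rs) ∧
    ∃ p₁ p₀ : ℝ, p₁ < p₀ ∧
    ∃ (rb : ℝ → ℝ) (wm wp : ℝ → RadialFlow),
      -- existence, smoothness and uniqueness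
      (∀ pex ∈ Ioo p₁ p₀,
        IsShockSolution d γ r₁ pex (rb pex) (wm pex) (wp pex) ∧
        (wm pex).SmoothOn (Icc d.r₀ (rb pex)) ∧
        (wp pex).SmoothOn (Icc (rb pex) r₁) ∧
        (∀ r ∈ Ioo d.r₀ (rb pex), (wm pex).soundSpeed γ r < (wm pex).U₁ r) ∧
        (∀ r ∈ Ioo (rb pex) r₁, (wp pex).U₁ r < (wp pex).soundSpeed γ r) ∧
        (∀ (rb' : ℝ) (wm' wp' : RadialFlow), IsShockSolution d γ r₁ pex rb' wm' wp' →
          rb' = rb pex ∧ wm'.AgreeOn (wm pex) (Icc d.r₀ (rb pex)) ∧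
          wp'.AgreeOn (wp pex) (Icc (rb pex) r₁))) ∧
      -- (A) dependence of the shock position on the exit pressure
      StrictAntiOn rb (Ioo p₁ p₀) ∧
      Tendsto rb (𝓝[>] p₁) (𝓝 r₁) ∧
      Tendsto rb (𝓝[<] p₀) (𝓝 d.r₀) ∧
      -- (B) case 1
      (r₁ ≤ rs → ∀ pex ∈ Ioo p₁ p₀,
        SupersonicShockPatterns d γ r₁ pex (rb pex) (wm pex) (wp pex)) ∧
      -- (B) case 2
      (d.r₀ < rs → rs < r₁ → ∃ ps ∈ Ioo p₁ p₀,
        (∀ pex ∈ Ioo ps p₀,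
          SupersonicShockPatterns d γ r₁ pex (rb pex) (wm pex) (wp pex)) ∧
        (∀ pex ∈ Ioo p₁ ps,
          IsSupersonicSubsonicShock γ (rb pex) (wm pex) (wp pex) ∧
          ∀ r ∈ Icc (rb pex) r₁, (wp pex).machSq γ r < 1) ∧
        IsSupersonicSonicShock γ (rb ps) (wm ps) (wp ps) ∧
        ∀ r ∈ Ioc (rb ps) r₁, (wp ps).machSq γ r < 1) ∧
      -- (B) case 3
      (rs ≤ d.r₀ → ∀ pex ∈ Ioo p₁ p₀,
        IsSupersonicSubsonicShock γ (rb pex) (wm pex) (wp pex) ∧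
        ∃ m < 1, ∀ r ∈ Icc (rb pex) r₁, (wp pex).machSq γ r ≤ m) := by
  have h0 := Inlet.reaches_r₀ hγ hd
  obtain ⟨rs, hRs, hgs⟩ := Inlet.exists_shockGap_eq hγ hd
  refine ⟨rs, (Inlet.isThreshold_iff hγ hd).2 ⟨hRs, hgs⟩, fun r hrt => ?_, ?_⟩
  · obtain ⟨hR, hg⟩ := (Inlet.isThreshold_iff hγ hd).1 hrt
    refine le_antisymm (not_lt.1 fun h => ?_) (not_lt.1 fun h => ?_)
    · exact (hRs.shockGap_lt hγ hd h).ne (hgs.trans hg.symm)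
    · exact (hR.shockGap_lt hγ hd h).ne (hg.trans hgs.symm)
  have hanti := Inlet.exitPressure_strictAntiOn (r₁ := r₁) hγ hd
  have hcont := Inlet.continuousOn_exitPressure (r₁ := r₁) hγ hd
  have hl : d.r₀ ∈ Icc d.r₀ r₁ := left_mem_Icc.2 hr.le
  have hu : r₁ ∈ Icc d.r₀ r₁ := right_mem_Icc.2 hr.le
  -- The limits are `p₁ = P r₁` and `p₀ = P r₀`, the exit pressures for a shock placed on the exit
  -- or the entrance circle.
  set P := d.exitPressure γ r₁ with hPdef
  have hex : ∀ pex ∈ Ioo (P r₁) (P d.r₀), ∃ b ∈ Ioo d.r₀ r₁, P b = pex := fun pex hp =>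
    intermediate_value_Ioo' hr.le hcont hp
  choose! rb hrb hP using hex
  have hPmem : ∀ b ∈ Ioo d.r₀ r₁, P b ∈ Ioo (P r₁) (P d.r₀) := fun b hb =>
    ⟨hanti (Ioo_subset_Icc_self hb) hu hb.2, hanti hl (Ioo_subset_Icc_self hb) hb.1⟩
  have hlt : ∀ pex ∈ Ioo (P r₁) (P d.r₀), ∀ b ∈ Icc d.r₀ r₁, (pex < P b ↔ b < rb pex) := by
    intro pex hp b hb
    conv_lhs => rw [← hP pex hp]
    exact hanti.lt_iff_gt (Ioo_subset_Icc_self (hrb pex hp)) hb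
  have hgt : ∀ pex ∈ Ioo (P r₁) (P d.r₀), ∀ b ∈ Icc d.r₀ r₁, (P b < pex ↔ rb pex < b) := by
    intro pex hp b hb
    conv_lhs => rw [← hP pex hp]
    exact hanti.lt_iff_gt hb (Ioo_subset_Icc_self (hrb pex hp))
  have hR : ∀ pex ∈ Ioo (P r₁) (P d.r₀), d.Reaches γ (rb pex) := fun pex hp =>
    h0.mono hγ hd (hrb pex hp).1.le
  have hpat : ∀ pex ∈ Ioo (P r₁) (P d.r₀), rb pex < rs →
      SupersonicShockPatterns d γ r₁ pex (rb pex) (d.inFlow γ) (d.outFlow γ (rb pex)) := by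
    intro pex hp hlts
    have h := Inlet.supersonicShockPatterns hγ hd (hrb pex hp)
      (hgs ▸ (hR pex hp).shockGap_lt hγ hd hlts)
    rwa [← hPdef, hP pex hp] at h
  have hsub : ∀ pex ∈ Ioo (P r₁) (P d.r₀), rs < rb pex → ∀ r, rb pex ≤ r →
      (d.outFlow γ (rb pex)).machSq γ r < 1 := fun pex hp hlts r hr' =>
    (hR pex hp).machSq_lt_one hγ hd (hgs ▸ hRs.shockGap_lt hγ hd hlts) hr'
  refine ⟨P r₁, P d.r₀, hanti hl hu hr, rb, fun _ => d.inFlow γ, fun pex => d.outFlow γ (rb pex),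
    ?_, ?_, ?_, ?_, ?_, ?_, ?_⟩
  · intro pex hp
    refine ⟨?_, h0.inFlow_smoothOn hγ hd, (hR pex hp).outFlow_smoothOn hγ hd,
      fun r hr' => (h0.mono hγ hd hr'.1.le).soundSpeed_lt hγ hd,
      fun r hr' => (hR pex hp).lt_soundSpeed hγ hd hr'.1.le, ?_⟩
    · have h := Inlet.isShockSolution hγ hd (hrb pex hp)
      rwa [← hPdef, hP pex hp] at h
    · intro b wm wp hs
      obtain ⟨h1, h2, h3⟩ := Inlet.agreeOn_of_isShockSolution hγ hd hs
      have hb : b = rb pex := hanti.injOn (Ioo_subset_Icc_self hs.location)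
        (Ioo_subset_Icc_self (hrb pex hp)) (h1.symm.trans (hP pex hp).symm)
      subst hb
      exact ⟨rfl, h2, h3⟩
  · intro p hp q hq hpq
    rwa [← hlt p hp _ (Ioo_subset_Icc_self (hrb q hq)), hP q hq]
  · rw [tendsto_order]
    constructor
    · intro a ha
      -- The midpoint keeps the comparison radius inside the annulus when `a ≤ r₀`.
      have hb : max a ((d.r₀ + r₁) / 2) ∈ Ioo d.r₀ r₁ :=
        ⟨lt_max_of_lt_right (by linarith), max_lt ha (by linarith)⟩
      filter_upwards [Ioo_mem_nhdsGT (hPmem _ hb).1] with p hp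
      exact (le_max_left _ _).trans_lt
        ((hlt p ⟨hp.1, hp.2.trans (hPmem _ hb).2⟩ _ (Ioo_subset_Icc_self hb)).1 hp.2)
    · intro a ha
      filter_upwards [Ioo_mem_nhdsGT (hanti hl hu hr)] with p hp
      exact (hrb p hp).2.trans ha
  · rw [tendsto_order]
    constructor
    · intro a ha
      filter_upwards [Ioo_mem_nhdsLT (hanti hl hu hr)] with p hp
      exact ha.trans (hrb p hp).1
    · intro a ha
      have hb : min a ((d.r₀ + r₁) / 2) ∈ Ioo d.r₀ r₁ :=
        ⟨lt_min ha (by linarith), min_lt_of_right_lt (by linarith)⟩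
      filter_upwards [Ioo_mem_nhdsLT (hPmem _ hb).2] with p hp
      exact ((hgt p ⟨(hPmem _ hb).1.trans hp.1, hp.2⟩ _ (Ioo_subset_Icc_self hb)).1 hp.1).trans_le
        (min_le_left _ _)
  · exact fun hrs pex hp => hpat pex hp ((hrb pex hp).2.trans_le hrs)
  · intro h1 h2
    -- The critical pressure `p'_*` is the one whose shock stands at the threshold radius.
    have hps := hPmem rs ⟨h1, h2⟩
    have hrs : rb (P rs) = rs := hanti.injOn (Ioo_subset_Icc_self (hrb _ hps)) ⟨h1.le, h2.le⟩
      (hP _ hps)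
    refine ⟨P rs, hps, fun pex hp => ?_, fun pex hp => ?_, ?_, ?_⟩
    · have hp' : pex ∈ Ioo (P r₁) (P d.r₀) := ⟨hps.1.trans hp.1, hp.2⟩
      exact hpat pex hp' ((hgt pex hp' rs ⟨h1.le, h2.le⟩).1 hp.1)
    · have hp' : pex ∈ Ioo (P r₁) (P d.r₀) := ⟨hp.1, hp.2.trans hps.2⟩
      have h3 := hsub pex hp' ((hlt pex hp' rs ⟨h1.le, h2.le⟩).1 hp.2)
      exact ⟨⟨(hR pex hp').one_lt_machSq_inFlow hγ hd, h3 _ le_rfl⟩, fun r hr' => h3 r hr'.1⟩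
    · beta_reduce
      rw [hrs]
      refine ⟨hRs.one_lt_machSq_inFlow hγ hd, ?_⟩
      rw [hRs.machSq_eq_one_iff hγ hd le_rfl, hRs.sonicGap_self hγ hd, hgs]
    · beta_reduce
      rw [hrs]
      intro r hr'
      rw [hRs.machSq_lt_one_iff hγ hd hr'.1.le, ← hgs, ← hRs.sonicGap_self hγ hd]
      exact hRs.sonicGap_lt hγ hd le_rfl hr'.1
  · intro hrs pex hp
    have h3 := hsub pex hp (hrs.trans_lt (hrb pex hp).1)
    refine ⟨⟨(hR pex hp).one_lt_machSq_inFlow hγ hd, h3 _ le_rfl⟩, ?_⟩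
    have he := (hR pex hp).outFlow_isEulerOn hγ hd (s := r₁)
    -- The uniform bound is the maximum of a continuous function on the closed interval.
    have hc : ContinuousOn ((d.outFlow γ (rb pex)).machSq γ) (Icc (rb pex) r₁) := by
      have hcs : ContinuousOn ((d.outFlow γ (rb pex)).soundSpeed γ) (Icc (rb pex) r₁) :=
        ((continuousOn_const.mul he.continuousOn_pressure).div he.cont_ρ
          fun r hr' => (he.ρ_pos r hr').ne').sqrt
      exact ((he.cont_U₁.pow 2).add (he.cont_U₂.pow 2)).div (hcs.pow 2) fun r hr' =>
        (pow_pos (((hR pex hp).outFlow_hasInvariants hγ hd hr'.1).soundSpeed_pos hγ) 2).ne'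
    obtain ⟨q, hq, hmax⟩ := isCompact_Icc.exists_isMaxOn
      (nonempty_Icc.2 (hrb pex hp).2.le) hc
    exact ⟨_, h3 q hq.1, fun r hr' => hmax hr'⟩
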